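/- Let $n\ge 1$ and $m\ge 0$ be integers and let $\nu,\beta,\sigma\in\mathbb{C}$ satisfy $\nu-\sigma-n=m$, $\nu-n\notin\{0,-1,-2,\dots\}$, $\beta-n+1\notin\{0,-1,-2,\dots\}$ and $\beta+\sigma\notin\{0,-1,-2,\dots\}$ (the conditions on $\nu$ and $\beta$ hold in particular whenever $\nu,\beta\notin\mathbb{Z}$, and all three hold whenever $\mathrm{Re}(\nu)>m+n$ and $\mathrm{Re}(\beta)>m+n$). Let $z\in\mathbb{C}$ with $|1-z|<1$, $z\neq1$ and $|\arg(1-z)|<\pi$. Write $(a)_k=a(a+1)\cdots(a+k-1)$, $\psi=\Gamma'/\Gamma$, let $\log$ be the principal logarithm, read $1/\Gamma$ as $0$ at the poles of $\Gamma$, and let ${}_3F_2$ denote the principal branch, i.e. the analytic continuation of the hypergeometric series from $|z|<1$ to $\mathbb{C}\setminus[1,\infty)$. Then the infinite series below converges absolutely and $$ \begin{aligned} &\frac{\Gamma(\beta)(\nu-n)_n}{\Gamma(\beta+\sigma)(\nu-n)(n-1)!}\,z^{n-1}\,{}_3F_2(\beta,\nu,1;\beta+\sigma,n;z)\\ &=\frac{(1-z)^{n-\nu-1+\sigma}}{\Gamma(1-n+\nu)}\sum_{k=0}^{\nu-\sigma-n}\frac{(-1)^k}{k!}(\beta+\sigma-\nu)_k(\sigma)_k\,\Gamma(1+\nu-\sigma-n-k)\,(1-z)^k\\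 &\quad+(-1)^{\nu-\sigma-n}\frac{\Gamma(\beta-n+1)}{\Gamma(\beta+\sigma-\nu)\Gamma(\sigma)}\sum_{k=0}^{\infty}\frac{(\beta-n+1)_k(\nu+1-n)_k}{(k+\nu-\sigma-n+1)!\,k!}\big[\log(1-z)-\psi(k+1)\\ &\qquad\qquad+\psi(k+\nu+1-n)+\psi(\beta-n+k+1)-\psi(\nu-\sigma-n+2+k)\big](1-z)^k\\ &\quad-\sum_{l=0}^{n-2}\frac{1}{l!}\left[\sum_{k=l}^{n-2}\frac{(\nu-n+1)_k\,\Gamma(k-n+\beta+1)}{\Gamma(k-n+\beta+\sigma+1)\,(k-l)!}\right](z-1)^l . \end{aligned} $$ In particular, with $\sigma=\nu-m-n$ eliminated (and $\beta+\nu-m-n\notin\{0,-1,-2,\dots\}$), $$ \begin{aligned} &\frac{\Gamma(\beta)(\nu-n)_n}{\Gamma(\beta+\nu-m-n)(\nu-n)(n-1)!}\,z^{n-1}\,{}_3F_2(\beta,\nu,1;\beta+\nu-m-n,n;z)\\ &=\frac{(1-z)^{-m-1}}{\Gamma(1-n+\nu)}\sum_{k=0}^{m}\frac{(-1)^k}{k!}(\beta-m-n)_k(\nu-m-n)_k\,\Gamma(1+m-k)\,(1-z)^k\\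 &\quad+(-1)^{m}\frac{\Gamma(\beta-n+1)}{\Gamma(\beta-m-n)\Gamma(\nu-m-n)}\sum_{k=0}^{\infty}\frac{(\beta-n+1)_k(\nu+1-n)_k}{(k+m+1)!\,k!}\big[\log(1-z)-\psi(k+1)\\ &\qquad\qquad+\psi(k+\nu+1-n)+\psi(\beta-n+k+1)-\psi(k+m+2)\big](1-z)^k\\ &\quad-\sum_{l=0}^{n-2}\frac{1}{l!}\left[\sum_{k=l}^{n-2}\frac{(\nu-n+1)_k\,\Gamma(k-n+\beta+1)}{\Gamma(k-2n-m+\nu+\beta+1)\,(k-l)!}\right](z-1)^l . \end{aligned} $$ (Empty sums are zero.) -/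

import Mathlib

open scoped Nat Topology

/-- The Pochhammer symbol (rising factorial) `(a)_k = a (a + 1) ⋯ (a + k - 1)`. -/
noncomputable def poch (a : ℂ) (k : ℕ) : ℂ := (ascPochhammer ℂ k).eval a

/-- The generalized hypergeometric series
`∑ₖ (a₁)_k (a₂)_k (a₃)_k / ((b₁)_k (b₂)_k) * z ^ k / k!`, convergent for `‖z‖ < 1` whenever neither
`b₁` nor `b₂` is a non-positive integer. -/
noncomputable def hypSeries3F2 (a₁ a₂ a₃ b₁ b₂ z : ℂ) : ℂ :=
  ∑' k : ℕ, poch a₁ k * poch a₂ k * poch a₃ k / (poch b₁ k * poch b₂ k) * (z ^ k / (k ! : ℂ))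

/-- `w` is the value at `z` of an analytic continuation of the hypergeometric series to an open set
that contains `0` and `z` and is star-shaped about `0`, that is, the value obtained from the series
by continuation along the straight segment from `0` to `z`. The cut plane `ℂ \ [1, ∞)` is
star-shaped about `0`, so for `z` in the cut plane this is the value of the principal branch of
`₃F₂` (and for `‖z‖ < 1` it is the sum of the series). -/
def Is3F2Value (a₁ a₂ a₃ b₁ b₂ z w : ℂ) : Prop :=
  ∃ (U : Set ℂ) (F : ℂ → ℂ), IsOpen U ∧ StarConvex ℝ 0 U ∧ (0 : ℂ) ∈ U ∧ z ∈ U ∧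
    DifferentiableOn ℂ F U ∧ (∀ᶠ x in 𝓝 (0 : ℂ), F x = hypSeries3F2 a₁ a₂ a₃ b₁ b₂ x) ∧ F z = w

/-- There is at most one such value. -/
theorem Is3F2Value.unique {a₁ a₂ a₃ b₁ b₂ z w w' : ℂ} (h : Is3F2Value a₁ a₂ a₃ b₁ b₂ z w)
    (h' : Is3F2Value a₁ a₂ a₃ b₁ b₂ z w') : w = w' := by
  obtain ⟨U, F, hU, hsU, h0U, hzU, hF, hF0, rfl⟩ := h
  obtain ⟨V, G, hV, hsV, h0V, hzV, hG, hG0, rfl⟩ := h'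
  have hUV : IsOpen (U ∩ V) := hU.inter hV
  have hconn : IsPreconnected (U ∩ V) :=
    ((hsU.inter hsV).isPathConnected ⟨h0U, h0V⟩).isConnected.isPreconnected
  have hFa := (hF.mono Set.inter_subset_left).analyticOnNhd hUV
  have hGa := (hG.mono Set.inter_subset_right).analyticOnNhd hUV
  refine hFa.eqOn_of_preconnected_of_eventuallyEq hGa hconn ⟨h0U, h0V⟩ ?_ ⟨hzU, hzV⟩
  filter_upwards [hF0, hG0] with x h1 h2
  rw [h1, h2]

open Classical in
/-- The generalized hypergeometric function `₃F₂(a₁, a₂, a₃; b₁, b₂; z)` (principal branch), the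
analytic continuation of the hypergeometric series. -/
noncomputable def hyp3F2 (a₁ a₂ a₃ b₁ b₂ z : ℂ) : ℂ :=
  if h : ∃ w, Is3F2Value a₁ a₂ a₃ b₁ b₂ z w then h.choose else 0

/-- The values of `hyp3F2` are the ones intended. -/
theorem Is3F2Value.hyp3F2_eq {a₁ a₂ a₃ b₁ b₂ z w : ℂ} (h : Is3F2Value a₁ a₂ a₃ b₁ b₂ z w) :
    hyp3F2 a₁ a₂ a₃ b₁ b₂ z = w := by
  have hex : ∃ w, Is3F2Value a₁ a₂ a₃ b₁ b₂ z w := ⟨w, h⟩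
  rw [hyp3F2, dif_pos hex]
  exact hex.choose_spec.unique h

/-! Put N = n - 1, a = β - N, b = ν - N, M = m + 1, c = a + b - M. Since the upper parameter 1
cancels k! and (N + 1)_j = (N + j)!/N!, the function z^N ₃F₂ is, up to the constant `tailFactor`,
the tail from index N of the series ∑ Γ(a+k)Γ(b+k)/(Γ(c+k) k!) z^k, a regularized ₂F₁(a, b; c; z).
The removed polynomial, re-expanded about 1, is the last sum of the formula. What remains is the
logarithmic connection formula for ₂F₁ when c - a - b = -M (`pser_hypCoef_eq`). Working with
1/Γ(c+k) avoids any condition on c itself.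

That formula is proved by induction on M. The operator z d/dz + (c - 1) lowers c by one on the
series side (`hypCoef_shift`). On the side expanded in w = 1 - z it sends the polar part and the
logarithmic part to their successors, up to two 1/w terms that cancel (`polarPart_succ`,
`logSer_succ`).

The base case M = 0 (`pser_zero_balanced`) compares two solutions of one hypergeometric equation.
Their sum E, together with P = (1 - x) E', solves a first-order system near x = 1, and a contraction
argument shows that E = 0 once E and P tend to 0 (`eventually_eq_zero_of_system`). The limit of P
needs Gauss's theorem with excess 1. The limit of E needs the regularized value 2ψ(1) - ψ(a) - ψ(b)
of the divergent series at 1 (`tsum_hypCoef_zero_balanced`). This value comes from Gauss's theorem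
at c = a + b + ε, minus its instance a = b = 1, as ε → 0⁺. A bound O(k⁻²) uniform in ε lets the
limit pass through the sum. Analyticity carries E = 0 to the lens |z| < 1, |1 - z| < 1.

Finally the series in the unit disc and the closed form in the slit disc about 1 are glued on a
domain star-shaped about 0, which identifies the principal branch (`is3F2Value_connectionRhs`). -/

open Filter

/-! ### Power series in the unit disc -/

/-- Absolute convergence of the power series `∑ cₖ zᵏ` in the open unit disc. -/
def ConvDisc (c : ℕ → ℂ) : Prop :=
  ∀ r : ℝ, 0 ≤ r → r < 1 → Summable fun k => ‖c k‖ * r ^ k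

/-- The sum of the power series with coefficients `c`. -/
noncomputable def pser (c : ℕ → ℂ) (z : ℂ) : ℂ := ∑' k, c k * z ^ k

namespace ConvDisc

variable {c d : ℕ → ℂ}

theorem summable (hc : ConvDisc c) {z : ℂ} (hz : ‖z‖ < 1) : Summable fun k => c k * z ^ k := by
  refine Summable.of_norm ?_
  simpa [norm_mul, norm_pow] using hc ‖z‖ (norm_nonneg _) hz

theorem of_norm_le (hc : ConvDisc c) (K : ℝ) (h : ∀ k, ‖d k‖ ≤ K * ‖c k‖) : ConvDisc d := by
  intro r h0 h1
  refine Summable.of_nonneg_of_le (fun k => by positivity) (fun k => ?_)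
    ((hc r h0 h1).mul_left K)
  rw [← mul_assoc]
  exact mul_le_mul_of_nonneg_right (h k) (by positivity)

theorem const_mul (hc : ConvDisc c) (a : ℂ) : ConvDisc fun k => a * c k :=
  hc.of_norm_le ‖a‖ fun k => by rw [norm_mul]

theorem add (hc : ConvDisc c) (hd : ConvDisc d) : ConvDisc fun k => c k + d k := by
  intro r h0 h1
  refine Summable.of_nonneg_of_le (fun k => by positivity) (fun k => ?_)
    ((hc r h0 h1).add (hd r h0 h1))
  rw [← add_mul]
  exact mul_le_mul_of_nonneg_right (norm_add_le _ _) (by positivity)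

/-- A slightly larger radius ρ absorbs the factor k, because k (r/ρ)^k is bounded. Hence z d/dz can
be applied termwise any number of times. -/
theorem natCast_mul (hc : ConvDisc c) : ConvDisc fun k => (k : ℂ) * c k := by
  intro r h0 h1
  obtain ⟨ρ, hr, hρ⟩ := exists_between h1
  have hρ0 : 0 < ρ := h0.trans_lt hr
  have hq : Tendsto (fun k : ℕ => (k : ℝ) * (r / ρ) ^ k) atTop (𝓝 0) :=
    tendsto_self_mul_const_pow_of_lt_one (by positivity) ((div_lt_one hρ0).2 hr)
  obtain ⟨K, hK⟩ := hq.bddAbove_range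
  refine Summable.of_nonneg_of_le (fun k => by positivity) (fun k => ?_)
    ((hc ρ hρ0.le hρ).mul_left K)
  have h2 : (k : ℝ) * (r / ρ) ^ k ≤ K := hK ⟨k, rfl⟩
  have h3 : ‖(k : ℂ) * c k‖ * r ^ k = ((k : ℝ) * (r / ρ) ^ k) * (‖c k‖ * ρ ^ k) := by
    rw [norm_mul, Complex.norm_natCast, div_pow]
    field_simp
  rw [h3]
  exact mul_le_mul_of_nonneg_right h2 (by positivity)

theorem succ (hc : ConvDisc c) : ConvDisc fun k => c (k + 1) := by
  intro r h0 h1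
  obtain ⟨ρ, hr, hρ⟩ := exists_between h1
  have hρ0 : 0 < ρ := h0.trans_lt hr
  refine Summable.of_nonneg_of_le (fun k => by positivity) (fun k => ?_)
    (((summable_nat_add_iff 1).2 (hc ρ hρ0.le hρ)).mul_left ρ⁻¹)
  have : ρ⁻¹ * (‖c (k + 1)‖ * ρ ^ (k + 1)) = ‖c (k + 1)‖ * ρ ^ k := by
    rw [pow_succ]
    field_simp
  rw [this]
  gcongr

theorem deriv (hc : ConvDisc c) : ConvDisc fun k => ((k : ℂ) + 1) * c (k + 1) := by
  have := hc.natCast_mul.succ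
  simpa using this

theorem natAdd (hc : ConvDisc c) (N : ℕ) : ConvDisc fun k => c (N + k) := by
  induction N with
  | zero => simpa using hc
  | succ N ih => simpa [add_assoc, add_comm 1] using ih.succ

theorem of_ratio (h0 : ∀ k, c k ≠ 0)
    (h : Tendsto (fun k => ‖c (k + 1)‖ / ‖c k‖) atTop (𝓝 1)) : ConvDisc c := by
  intro r hr h1
  rcases hr.eq_or_lt with rfl | hr
  · refine summable_of_ne_finset_zero (s := {0}) fun k hk => ?_
    have : k ≠ 0 := by simpa using hk
    simp [this]
  refine summable_of_ratio_test_tendsto_lt_one h1 (Eventually.of_forall fun k => ?_) ?_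
  · exact mul_ne_zero (norm_ne_zero_iff.2 (h0 k)) (pow_ne_zero _ hr.ne')
  · have h2 := h.mul_const r
    rw [one_mul] at h2
    refine h2.congr fun k => ?_
    have h3 : ‖c k‖ ≠ 0 := norm_ne_zero_iff.2 (h0 k)
    rw [norm_mul, norm_mul, norm_pow, norm_pow, norm_norm, norm_norm, Real.norm_of_nonneg hr.le, pow_succ]
    field_simp

theorem of_bounded (K : ℝ) (h : ∀ k, ‖c k‖ ≤ K) : ConvDisc c := by
  intro r h0 h1
  refine Summable.of_nonneg_of_le (fun k => by positivity) (fun k => ?_)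
    ((summable_geometric_of_lt_one h0 h1).mul_left K)
  gcongr
  exact h k

theorem pser_eq (hc : ConvDisc c) {z : ℂ} (hz : ‖z‖ < 1) :
    pser c z = c 0 + z * pser (fun k => c (k + 1)) z := by
  rw [pser, (hc.summable hz).tsum_eq_zero_add, pser, ← tsum_mul_left]
  simp only [pow_zero, mul_one]
  congr 1
  exact tsum_congr fun k => by ring

theorem pser_add (hc : ConvDisc c) (hd : ConvDisc d) {z : ℂ} (hz : ‖z‖ < 1) :
    pser (fun k => c k + d k) z = pser c z + pser d z := by
  simp only [pser, add_mul]
  exact (hc.summable hz).tsum_add (hd.summable hz)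

end ConvDisc

theorem pser_const_mul (c : ℕ → ℂ) (a z : ℂ) : pser (fun k => a * c k) z = a * pser c z := by
  simp only [pser, mul_assoc]
  exact tsum_mul_left

theorem pser_zero (c : ℕ → ℂ) : pser c 0 = c 0 := by
  rw [pser, tsum_eq_single 0 (fun k hk => by simp [hk])]
  simp

theorem ConvDisc.hasDerivAt {c : ℕ → ℂ} (hc : ConvDisc c) {z : ℂ} (hz : ‖z‖ < 1) :
    HasDerivAt (pser c) (pser (fun k => ((k : ℂ) + 1) * c (k + 1)) z) z := by
  obtain ⟨r, hr, h1⟩ := exists_between hz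
  have h0 : 0 < r := (norm_nonneg _).trans_lt hr
  -- This dominates k‖c k‖ r^(k-1). Writing the power as r^k r⁻¹ avoids truncated subtraction; at k
  -- = 0 the factor k vanishes.
  have hs : Summable fun k : ℕ => ‖(k : ℂ) * c k‖ * r ^ k * r⁻¹ :=
    (hc.natCast_mul r h0.le h1).mul_right _
  have key := hasDerivAt_tsum_of_isPreconnected (g := fun (k : ℕ) (z : ℂ) => c k * z ^ k)
    (g' := fun (k : ℕ) (z : ℂ) => c k * ((k : ℂ) * z ^ (k - 1))) (y₀ := 0) (y := z) hs
    (Metric.isOpen_ball (x := (0 : ℂ)) (ε := r)) (convex_ball _ _).isPreconnected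
    (fun k y _ => (hasDerivAt_pow k y).const_mul (c k)) ?_ (Metric.mem_ball_self h0)
    (hc.summable (by simp)) (by simpa using hr)
  · have hs2 : Summable fun k : ℕ => c k * ((k : ℂ) * z ^ (k - 1)) := by
      refine (summable_nat_add_iff 1).1 ((hc.deriv.summable hz).congr fun k => ?_)
      push_cast
      ring
    rw [hs2.tsum_eq_zero_add] at key
    simp only [Nat.cast_zero, zero_mul, mul_zero, zero_add] at key
    refine key.congr_deriv (tsum_congr fun k => ?_)
    push_cast
    ring
  · intro k y hy
    rw [Metric.mem_ball, dist_zero_right] at hy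
    rcases Nat.eq_zero_or_pos k with rfl | hk
    · simp
    obtain ⟨j, rfl⟩ : ∃ j, k = j + 1 := ⟨k - 1, by omega⟩
    rw [Nat.add_sub_cancel, norm_mul, norm_mul, norm_pow, norm_mul, pow_succ]
    have : ‖((j + 1 : ℕ) : ℂ)‖ * ‖c (j + 1)‖ * (r ^ j * r) * r⁻¹
        = ‖c (j + 1)‖ * (‖((j + 1 : ℕ) : ℂ)‖ * r ^ j) := by field_simp
    rw [this]
    gcongr

theorem ConvDisc.mul_deriv_eq {c : ℕ → ℂ} (hc : ConvDisc c) {z : ℂ} (hz : ‖z‖ < 1) :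
    z * pser (fun k => ((k : ℂ) + 1) * c (k + 1)) z = pser (fun k => (k : ℂ) * c k) z := by
  rw [hc.natCast_mul.pser_eq hz]
  simp

theorem ConvDisc.continuousAt {c : ℕ → ℂ} (hc : ConvDisc c) {z : ℂ} (hz : ‖z‖ < 1) :
    ContinuousAt (pser c) z := (hc.hasDerivAt hz).continuousAt

/-! ### Power series with a logarithm -/

/-- The function `log w * ∑ Aₖ wᵏ + ∑ Bₖ wᵏ`. -/
noncomputable def logSer (A B : ℕ → ℂ) (w : ℂ) : ℂ := Complex.log w * pser A w + pser B w

/-- Because w d/dw sends log w to 1, it acts on coefficient pairs by (A, B) ↦ (kA, kB + A).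
Differential equations thus become recurrences on pairs. -/
theorem logSer_hasDerivAt {A B : ℕ → ℂ} (hA : ConvDisc A) (hB : ConvDisc B) {w : ℂ}
    (hw : ‖w‖ < 1) (hs : w ∈ Complex.slitPlane) :
    HasDerivAt (logSer A B)
      (logSer (fun k => (k : ℂ) * A k) (fun k => (k : ℂ) * B k + A k) w / w) w := by
  have hw0 : w ≠ 0 := Complex.slitPlane_ne_zero hs
  have h := ((Complex.hasDerivAt_log hs).mul (hA.hasDerivAt hw)).add (hB.hasDerivAt hw)
  refine h.congr_deriv ?_
  rw [logSer, hB.natCast_mul.pser_add hA hw, ← hA.mul_deriv_eq hw, ← hB.mul_deriv_eq hw]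
  field_simp
  ring

theorem logSer_eq {A B : ℕ → ℂ} (hA : ConvDisc A) (hB : ConvDisc B) {w : ℂ} (hw : ‖w‖ < 1) :
    logSer A B w = Complex.log w * A 0 + B 0
      + w * logSer (fun k => A (k + 1)) (fun k => B (k + 1)) w := by
  rw [logSer, logSer, hA.pser_eq hw, hB.pser_eq hw]
  ring

theorem logSer_const_mul (A B : ℕ → ℂ) (a w : ℂ) :
    logSer (fun k => a * A k) (fun k => a * B k) w = a * logSer A B w := by
  rw [logSer, logSer, pser_const_mul, pser_const_mul]
  ring

theorem logSer_add {A B A' B' : ℕ → ℂ} (hA : ConvDisc A) (hB : ConvDisc B) (hA' : ConvDisc A')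
    (hB' : ConvDisc B') {w : ℂ} (hw : ‖w‖ < 1) :
    logSer (fun k => A k + A' k) (fun k => B k + B' k) w = logSer A B w + logSer A' B' w := by
  rw [logSer, logSer, logSer, hA.pser_add hA' hw, hB.pser_add hB' hw]
  ring

/-! ### Uniqueness at the singular point 1 -/

theorem tendsto_ofReal_one_sub : Tendsto (fun x : ℝ => (1 : ℂ) - x) (𝓝[<] 1) (𝓝 0) := by
  have : ContinuousAt (fun x : ℝ => (1 : ℂ) - x) 1 := by fun_prop
  simpa using (this.tendsto.mono_left nhdsWithin_le_nhds)

/-- `(1 - x) log (1 - x) → 0` as `x → 1⁻`. -/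
theorem tendsto_one_sub_mul_log :
    Tendsto (fun x : ℝ => ((1 : ℂ) - x) * Complex.log (1 - x)) (𝓝[<] 1) (𝓝 0) := by
  have h1 : Tendsto (fun x : ℝ => 1 - x) (𝓝[<] 1) (𝓝[>] 0) := by
    refine tendsto_nhdsWithin_iff.2 ⟨?_, ?_⟩
    · have : ContinuousAt (fun x : ℝ => (1 : ℝ) - x) 1 := by fun_prop
      simpa using (this.tendsto.mono_left nhdsWithin_le_nhds)
    · filter_upwards [self_mem_nhdsWithin] with x hx
      simpa using hx
  have h2 : Tendsto (fun x : ℝ => Real.log x * x) (𝓝[>] 0) (𝓝 0) :=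
    (by simpa using tendsto_log_mul_rpow_nhdsGT_zero (r := 1) one_pos)
  have h3 := (Complex.continuous_ofReal.tendsto 0).comp (h2.comp h1)
  rw [Complex.ofReal_zero] at h3
  refine h3.congr' ?_
  filter_upwards [self_mem_nhdsWithin] with x hx
  have hx' : (0 : ℝ) ≤ 1 - x := by
    have : x < 1 := hx
    linarith
  have := Complex.ofReal_log hx'
  simp only [Function.comp_apply]
  push_cast at this ⊢
  rw [this]
  ring

theorem norm_ofReal_one_sub_lt {x : ℝ} (h0 : 0 < x) (h1 : x < 1) : ‖(1 : ℂ) - x‖ < 1 := by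
  rw [← Complex.ofReal_one, ← Complex.ofReal_sub, Complex.norm_real, Real.norm_eq_abs, abs_lt]
  constructor <;> linarith

/-- A solution of the first-order system attached to the hypergeometric equation at a double
exponent `0` that vanishes at `1` is zero. -/
theorem eventually_eq_zero_of_system {E P : ℝ → ℂ} {p s : ℂ}
    (hE : ∀ x : ℝ, 1 / 2 < x → x < 1 → HasDerivAt E (P x / (1 - x)) x)
    (hP : ∀ x : ℝ, 1 / 2 < x → x < 1 → HasDerivAt P ((p * E x - s * P x) / x) x)
    (hE0 : Tendsto E (𝓝[<] 1) (𝓝 0)) (hP0 : Tendsto P (𝓝[<] 1) (𝓝 0)) :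
    ∀ᶠ x in 𝓝[<] (1 : ℝ), E x = 0 := by
  -- The 2 bounds 1/x on (1/2, 1). The summand 1 makes K ≥ 1, so that 1 - 1/(2K) is at least 1/2.
  set K : ℝ := 2 * (‖p‖ + ‖s‖) + 1 with hK
  have hK1 : 1 ≤ K := by have := norm_nonneg p; have := norm_nonneg s; linarith
  have hev : ∀ᶠ x in 𝓝[<] (1 : ℝ), ‖E x‖ < 1 ∧ ‖P x‖ < 1 := by
    have h1 := hE0.norm.eventually_lt_const (u := 1) (by simp)
    have h2 := hP0.norm.eventually_lt_const (u := 1) (by simp)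
    exact h1.and h2
  obtain ⟨y, hy1, hy⟩ := (mem_nhdsLT_iff_exists_Ioo_subset (a := (1 : ℝ))).1 hev
  set x₁ := max y (1 - 1 / (2 * K)) with hx₁
  have hx₁1 : x₁ < 1 := max_lt hy1 (by have : 0 < 1 / (2 * K) := by positivity
                                       linarith)
  have hhalf : 1 / 2 ≤ x₁ := by
    refine le_trans ?_ (le_max_right _ _)
    have : 1 / (2 * K) ≤ 1 / 2 := by
      apply one_div_le_one_div_of_le <;> linarith
    linarith
  have hKx : K * (1 - x₁) ≤ 1 / 2 := by
    have h1 : 1 - x₁ ≤ 1 / (2 * K) := by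
      have := le_max_right y (1 - 1 / (2 * K))
      linarith
    calc K * (1 - x₁) ≤ K * (1 / (2 * K)) := by gcongr
      _ = 1 / 2 := by field_simp
  -- a bound on the derivative near `1` and a zero limit at `1` give a linear bound
  have lin : ∀ (F F' : ℝ → ℂ) (C : ℝ), (∀ x, x₁ < x → x < 1 → HasDerivAt F (F' x) x) →
      (∀ x, x₁ < x → x < 1 → ‖F' x‖ ≤ C) → Tendsto F (𝓝[<] 1) (𝓝 0) →
      ∀ x, x₁ < x → x < 1 → ‖F x‖ ≤ C * (1 - x) := by
    intro F F' C hF hC hlim x hx hx1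
    have h1 : ∀ᶠ t in 𝓝[<] (1 : ℝ), ‖F t - F x‖ ≤ C * (t - x) := by
      filter_upwards [Ioo_mem_nhdsLT hx1] with t ht
      have := (convex_Ioo x₁ 1).norm_image_sub_le_of_norm_hasDerivWithin_le
        (f := F) (f' := F') (C := C) (fun u hu => (hF u hu.1 hu.2).hasDerivWithinAt)
        (fun u hu => hC u hu.1 hu.2) ⟨hx, hx1⟩ ⟨hx.trans ht.1, ht.2⟩
      rwa [Real.norm_of_nonneg (by linarith [ht.1])] at this
    have h2 : Tendsto (fun t : ℝ => C * (t - x)) (𝓝[<] 1) (𝓝 (C * (1 - x))) := by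
      have : ContinuousAt (fun t : ℝ => C * (t - x)) 1 := by fun_prop
      exact this.tendsto.mono_left nhdsWithin_le_nhds
    have h3 := le_of_tendsto_of_tendsto (hlim.sub_const (F x)).norm h2 h1
    simpa using h3
  -- Each round halves both bounds. The bound on P' makes P vanish linearly at 1, and this pays for
  -- the denominator 1 - x in E' = P/(1 - x).
  have main : ∀ n : ℕ, ∀ x, x₁ < x → x < 1 → ‖E x‖ ≤ (1 / 2) ^ n ∧ ‖P x‖ ≤ (1 / 2) ^ n := by
    intro n
    induction n with
    | zero =>
      intro x hx hx1
      have := hy ⟨(le_max_left _ _).trans_lt hx, hx1⟩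
      exact ⟨by simpa using this.1.le, by simpa using this.2.le⟩
    | succ n ih =>
      have hPl := lin P (fun x => (p * E x - s * P x) / x) (K * (1 / 2) ^ n)
        (fun x hx hx1 => hP x (hhalf.trans_lt hx) hx1) (fun x hx hx1 => by
          have hx0 : 1 / 2 < x := hhalf.trans_lt hx
          obtain ⟨h1, h2⟩ := ih x hx hx1
          rw [norm_div, Complex.norm_real, Real.norm_of_nonneg (by linarith),
            div_le_iff₀ (by linarith)]
          calc ‖p * E x - s * P x‖ ≤ ‖p‖ * ‖E x‖ + ‖s‖ * ‖P x‖ := by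
                rw [← norm_mul, ← norm_mul]; exact norm_sub_le _ _
            _ ≤ ‖p‖ * (1 / 2) ^ n + ‖s‖ * (1 / 2) ^ n := by gcongr
            _ = (‖p‖ + ‖s‖) * (1 / 2) ^ n := by ring
            _ ≤ (K * x) * (1 / 2) ^ n := by
                gcongr
                nlinarith
            _ = _ := by ring) hP0
      have hEl := lin E (fun x => P x / (1 - x)) (K * (1 / 2) ^ n)
        (fun x hx hx1 => hE x (hhalf.trans_lt hx) hx1) (fun x hx hx1 => by
          have h1 : (0 : ℝ) < 1 - x := by linarith
          have h2 : ‖(1 : ℂ) - x‖ = 1 - x := by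
            rw [← Complex.ofReal_one, ← Complex.ofReal_sub, Complex.norm_real,
              Real.norm_of_nonneg h1.le]
          rw [norm_div, h2, div_le_iff₀ h1]
          exact hPl x hx hx1) hE0
      intro x hx hx1
      have hb : K * (1 / 2) ^ n * (1 - x) ≤ (1 / 2) ^ (n + 1) := by
        calc K * (1 / 2) ^ n * (1 - x) = (1 / 2) ^ n * (K * (1 - x)) := by ring
          _ ≤ (1 / 2) ^ n * (K * (1 - x₁)) := by gcongr
          _ ≤ (1 / 2) ^ n * (1 / 2) := by gcongr
          _ = _ := by ring
      exact ⟨(hEl x hx hx1).trans hb, (hPl x hx hx1).trans hb⟩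
  filter_upwards [Ioo_mem_nhdsLT hx₁1] with x hx
  have hlim : Tendsto (fun n : ℕ => ((1 : ℝ) / 2) ^ n) atTop (𝓝 0) :=
    tendsto_pow_atTop_nhds_zero_of_lt_one (by norm_num) (by norm_num)
  have := ge_of_tendsto' hlim fun n => (main n x hx.1 hx.2).1
  exact norm_le_zero_iff.1 this

/-! ### Pochhammer symbols and Gamma asymptotics -/

theorem poch_zero (a : ℂ) : poch a 0 = 1 := by simp [poch]

theorem poch_succ (a : ℂ) (k : ℕ) : poch a (k + 1) = poch a k * (a + k) := by
  rw [poch, ascPochhammer_succ_eval, poch]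

theorem poch_succ_left (a : ℂ) (k : ℕ) : poch a (k + 1) = a * poch (a + 1) k := by
  induction k with
  | zero => simp [poch_succ, poch_zero]
  | succ k ih =>
    rw [poch_succ, ih, poch_succ]
    push_cast
    ring

theorem poch_ne_zero {a : ℂ} (ha : ∀ j : ℕ, a ≠ -(j : ℂ)) (k : ℕ) : poch a k ≠ 0 := by
  induction k with
  | zero => simp [poch_zero]
  | succ k ih =>
    rw [poch_succ]
    exact mul_ne_zero ih fun h => ha k (eq_neg_of_add_eq_zero_left h)

theorem add_natCast_ne {a : ℂ} (ha : ∀ j : ℕ, a ≠ -(j : ℂ)) (k j : ℕ) : a + k ≠ -(j : ℂ) := by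
  intro h
  refine ha (k + j) ?_
  push_cast
  linear_combination h

theorem ne_neg_natCast_of_re_pos {a : ℂ} (ha : 0 < a.re) (j : ℕ) : a ≠ -(j : ℂ) := by
  rintro rfl
  simp only [Complex.neg_re, Complex.natCast_re] at ha
  have : (0 : ℝ) ≤ j := j.cast_nonneg
  linarith

theorem add_natCast_ne_zero {a : ℂ} (ha : ∀ j : ℕ, a ≠ -(j : ℂ)) (k : ℕ) : a + k ≠ 0 := by
  simpa using add_natCast_ne ha k 0

theorem Gamma_add_natCast {a : ℂ} (ha : ∀ j : ℕ, a ≠ -(j : ℂ)) (k : ℕ) :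
    Complex.Gamma (a + k) = Complex.Gamma a * poch a k := by
  rw [poch, ← Complex.Gamma_add_nat_div_Gamma_eq a ha, mul_div_cancel₀ _ (Complex.Gamma_ne_zero ha)]

theorem Gamma_add_natCast_succ {a : ℂ} (ha : ∀ j : ℕ, a ≠ -(j : ℂ)) (k : ℕ) :
    Complex.Gamma (a + (k + 1 : ℕ)) = (a + k) * Complex.Gamma (a + k) := by
  rw [← Complex.Gamma_add_one _ (add_natCast_ne_zero ha k)]
  push_cast
  ring_nf

/-- `Γ (s + n + 1) ∼ n ^ s n!`. -/
theorem tendsto_Gamma_div_cpow_mul_factorial (s : ℂ) :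
    Tendsto (fun n : ℕ => Complex.Gamma (s + n + 1) / ((n : ℂ) ^ s * (n ! : ℂ))) atTop (𝓝 1) := by
  -- For Re s > 0 this is the Gauss limit for Γ(s). Other s are reached by descending from s + 1, so
  -- no pole has to be excluded: s + n + 1 ≠ 0 for large n.
  rcases exists_nat_gt (-s.re) with ⟨N, hs⟩
  induction N generalizing s with
  | zero =>
    have hre : 0 < s.re := by simpa using hs
    have hp := ne_neg_natCast_of_re_pos hre
    have h1 := (tendsto_const_nhds (x := Complex.Gamma s)).div
      (Complex.GammaSeq_tendsto_Gamma s) (Complex.Gamma_ne_zero hp)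
    rw [div_self (Complex.Gamma_ne_zero hp)] at h1
    refine h1.congr fun n => ?_
    have h2 : ∀ n : ℕ, ∏ j ∈ Finset.range n, (s + j) = poch s n := by
      intro n
      induction n with
      | zero => simp [poch_zero]
      | succ n ih => rw [Finset.prod_range_succ, ih, poch_succ]
    have h3 := Gamma_add_natCast hp (n + 1)
    push_cast at h3
    rw [Pi.div_apply, Complex.GammaSeq, h2, add_assoc, h3]
    field_simp
  | succ N ih =>
    have h1 := ih (s + 1) (by
      push_cast at hs
      simp only [Complex.add_re, Complex.one_re]
      linarith)
    have h2 : Tendsto (fun n : ℕ => (n : ℂ) / (n + (s + 1))) atTop (𝓝 1) :=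
      tendsto_natCast_div_add_atTop (s + 1)
    have h3 := h1.mul h2
    rw [mul_one] at h3
    refine h3.congr' ?_
    have hne : ∀ᶠ n : ℕ in atTop, (n : ℂ) + (s + 1) ≠ 0 := by
      obtain ⟨m, hm⟩ := exists_nat_gt (-(s.re + 1))
      filter_upwards [eventually_ge_atTop m] with n hn h
      have := congrArg Complex.re h
      simp only [Complex.add_re, Complex.natCast_re, Complex.one_re, Complex.zero_re] at this
      have hn' : (m : ℝ) ≤ n := by exact_mod_cast hn
      linarith
    filter_upwards [hne, eventually_gt_atTop 0] with n hn hn0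
    have hn0' : (n : ℂ) ≠ 0 := by exact_mod_cast hn0.ne'
    have h4 : Complex.Gamma (s + 1 + n + 1)
        = (n + (s + 1)) * Complex.Gamma (s + n + 1) := by
      rw [show s + 1 + n + 1 = (n + (s + 1)) + 1 by ring, Complex.Gamma_add_one _ hn,
        show (n : ℂ) + (s + 1) = s + n + 1 by ring]
    rw [h4, Complex.cpow_add _ _ hn0', Complex.cpow_one]
    field_simp

/-! ### Regularized hypergeometric coefficients and Gauss's theorem -/

/-- The coefficients `Γ(a + k) Γ(b + k) / (Γ(c + k) k!)`. -/
noncomputable def hypCoef (a b c : ℂ) (k : ℕ) : ℂ :=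
  Complex.Gamma (a + k) * Complex.Gamma (b + k) * (Complex.Gamma (c + k))⁻¹ / (k ! : ℂ)

theorem factorial_ne_zero_complex (k : ℕ) : (k ! : ℂ) ≠ 0 := by
  exact_mod_cast k.factorial_ne_zero

theorem natCast_add_one_ne_zero (k : ℕ) : (k : ℂ) + 1 ≠ 0 := by exact_mod_cast k.succ_ne_zero

theorem factorial_succ_complex (k : ℕ) : ((k + 1)! : ℂ) = (k + 1) * (k ! : ℂ) := by
  rw [Nat.factorial_succ]
  push_cast
  ring

theorem inv_Gamma_add_natCast (c : ℂ) (k : ℕ) :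
    (Complex.Gamma (c + k))⁻¹ = (c + k) * (Complex.Gamma (c + (k + 1 : ℕ)))⁻¹ := by
  rw [Complex.one_div_Gamma_eq_self_mul_one_div_Gamma_add_one]
  push_cast
  ring_nf

/-- The factor c + k stays on the left because it may vanish; 1/Γ(c+k) = (c+k)/Γ(c+k+1) holds at the
poles too. -/
theorem hypCoef_succ_mul {a b : ℂ} (ha : ∀ j : ℕ, a ≠ -(j : ℂ)) (hb : ∀ j : ℕ, b ≠ -(j : ℂ))
    (c : ℂ) (k : ℕ) :
    (c + k) * ((k + 1) * hypCoef a b c (k + 1)) = (a + k) * (b + k) * hypCoef a b c k := by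
  have hk := natCast_add_one_ne_zero k
  have hf := factorial_ne_zero_complex k
  rw [hypCoef, hypCoef, Gamma_add_natCast_succ ha, Gamma_add_natCast_succ hb,
    inv_Gamma_add_natCast c k, factorial_succ_complex]
  field_simp

/-- At series level, z d/dz + c lowers the parameter c + 1 to c. No condition on c is needed since
1/Γ is entire. -/
theorem hypCoef_eq_mul_succ_right (a b c : ℂ) (k : ℕ) :
    hypCoef a b c k = (c + k) * hypCoef a b (c + 1) k := by
  rw [hypCoef, hypCoef, inv_Gamma_add_natCast]
  push_cast
  rw [show c + (k + 1) = c + 1 + k by ring]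
  ring

/-- The factorials cancel in the quotient of the four Gamma asymptotics, k! being Γ(1 + k). The
index n + 1 matches the form Γ(s + n + 1) of those asymptotics. -/
theorem hypCoef_tendsto (a b c : ℂ) :
    Tendsto (fun n : ℕ => hypCoef a b c (n + 1) / (n : ℂ) ^ (a + b - c - 1)) atTop (𝓝 1) := by
  have h := (((tendsto_Gamma_div_cpow_mul_factorial a).mul
    (tendsto_Gamma_div_cpow_mul_factorial b)).div
    ((tendsto_Gamma_div_cpow_mul_factorial c).mul
    (tendsto_Gamma_div_cpow_mul_factorial 1)) (by norm_num))
  simp only [mul_one, div_one] at h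
  refine h.congr' ?_
  filter_upwards [eventually_gt_atTop 0] with n hn0
  have hn0' : (n : ℂ) ≠ 0 := by exact_mod_cast hn0.ne'
  have h1 : Complex.Gamma (1 + n + 1) = ((n + 1)! : ℂ) := by
    rw [← Complex.Gamma_nat_eq_factorial]
    push_cast
    ring_nf
  have hf := factorial_ne_zero_complex n
  have hf' := factorial_ne_zero_complex (n + 1)
  rw [Pi.div_apply, hypCoef, h1, Complex.cpow_sub _ _ hn0', Complex.cpow_sub _ _ hn0',
    Complex.cpow_add _ _ hn0', Complex.cpow_one]
  push_cast
  simp only [← add_assoc]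
  have e1 : (n : ℂ) ^ a ≠ 0 := by simp [Complex.cpow_eq_zero_iff, hn0']
  have e2 : (n : ℂ) ^ b ≠ 0 := by simp [Complex.cpow_eq_zero_iff, hn0']
  have e3 : (n : ℂ) ^ c ≠ 0 := by simp [Complex.cpow_eq_zero_iff, hn0']
  by_cases hG : Complex.Gamma (c + n + 1) = 0
  · simp [hG]
  · field_simp

theorem hypCoef_summable {a b c : ℂ} (h : 0 < (c - a - b).re) : Summable (hypCoef a b c) := by
  refine (summable_nat_add_iff 1).1 ?_
  have hs : Summable fun n : ℕ => (n : ℝ) ^ ((a + b - c - 1).re) := by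
    refine Real.summable_nat_rpow.2 ?_
    simp only [Complex.sub_re, Complex.add_re, Complex.one_re] at h ⊢
    linarith
  have hO := Asymptotics.isBigO_of_div_tendsto_nhds (f := fun n : ℕ => hypCoef a b c (n + 1))
    (g := fun n : ℕ => (n : ℂ) ^ (a + b - c - 1)) (l := atTop) ?_ 1 (hypCoef_tendsto a b c)
  · refine summable_of_isBigO_nat hs (hO.trans ?_)
    refine Asymptotics.IsBigO.of_bound 1 ?_
    filter_upwards [eventually_gt_atTop 0] with n hn
    rw [Complex.norm_natCast_cpow_of_pos hn, one_mul]
    exact le_abs_self _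
  · filter_upwards [eventually_gt_atTop 0] with n hn h0
    have hn0' : (n : ℂ) ≠ 0 := by exact_mod_cast hn.ne'
    simp [Complex.cpow_eq_zero_iff, hn0'] at h0

theorem tendsto_natCast_cpow_zero {x : ℂ} (hx : x.re < 0) :
    Tendsto (fun n : ℕ => (n : ℂ) ^ x) atTop (𝓝 0) := by
  rw [tendsto_zero_iff_norm_tendsto_zero]
  have h : Tendsto (fun n : ℕ => (n : ℝ) ^ x.re) atTop (𝓝 0) := by
    have := (tendsto_rpow_neg_atTop (y := -x.re) (by linarith)).comp tendsto_natCast_atTop_atTop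
    simpa [Function.comp_def] using this
  refine h.congr' ?_
  filter_upwards [eventually_gt_atTop 0] with n hn
  rw [Complex.norm_natCast_cpow_of_pos hn]

theorem natCast_mul_hypCoef_tendsto_zero {a b c : ℂ} (h : 0 < (c - a - b).re) :
    Tendsto (fun n : ℕ => (n : ℂ) * hypCoef a b c n) atTop (𝓝 0) := by
  refine (tendsto_add_atTop_iff_nat 1).1 ?_
  have h1 : Tendsto (fun n : ℕ => (n : ℂ) ^ (a + b - c)) atTop (𝓝 0) :=
    tendsto_natCast_cpow_zero (by
      simp only [Complex.sub_re, Complex.add_re] at h ⊢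
      linarith)
  have h2 : Tendsto (fun n : ℕ => ((n : ℂ) / (n + 1))⁻¹) atTop (𝓝 1⁻¹) :=
    (tendsto_natCast_div_add_atTop (1 : ℂ)).inv₀ one_ne_zero
  have h3 := ((hypCoef_tendsto a b c).mul h1).mul h2
  simp only [mul_zero, zero_mul] at h3
  refine h3.congr' ?_
  filter_upwards [eventually_gt_atTop 0] with n hn
  have hn0' : (n : ℂ) ≠ 0 := by exact_mod_cast hn.ne'
  have e : (n : ℂ) ^ (a + b - c) ≠ 0 := by simp [Complex.cpow_eq_zero_iff, hn0']
  rw [Complex.cpow_sub _ 1 hn0', Complex.cpow_one]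
  push_cast
  field_simp

/-- The contiguous relation behind Gauss's summation theorem. -/
theorem tsum_hypCoef_succ_right {a b c : ℂ} (ha : ∀ j : ℕ, a ≠ -(j : ℂ))
    (hb : ∀ j : ℕ, b ≠ -(j : ℂ)) (h : 0 < (c - a - b).re) :
    (c - a) * (c - b) * ∑' k, hypCoef a b (c + 1) k = (c - a - b) * ∑' k, hypCoef a b c k := by
  have h' : 0 < (c + 1 - a - b).re := by
    simp only [Complex.sub_re, Complex.add_re, Complex.one_re] at h ⊢
    linarith
  have hs := (hypCoef_summable h).mul_left (c - a - b)
  have hs' := (hypCoef_summable h').mul_left ((c - a) * (c - b))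
  have h1 := (hs'.sub hs).hasSum.tendsto_sum_nat
  rw [hs'.tsum_sub hs, tsum_mul_left, tsum_mul_left] at h1
  -- The combination telescopes: its partial sums are exactly N times a single coefficient, which is
  -- of order N^(a+b-c) and tends to 0.
  have h2 : ∀ N : ℕ, ∑ k ∈ Finset.range N, ((c - a) * (c - b) * hypCoef a b (c + 1) k
      - (c - a - b) * hypCoef a b c k) = N * hypCoef a b c N := by
    intro N
    induction N with
    | zero => simp
    | succ N ih =>
      rw [Finset.sum_range_succ, ih]
      have e1 : ((N : ℂ) + 1) * hypCoef a b c (N + 1)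
          = (a + N) * (b + N) * hypCoef a b (c + 1) N := by
        have hN := natCast_add_one_ne_zero N
        have hf := factorial_ne_zero_complex N
        rw [hypCoef, hypCoef, Gamma_add_natCast_succ ha, Gamma_add_natCast_succ hb,
          factorial_succ_complex]
        push_cast
        rw [show c + (N + 1) = c + 1 + N by ring]
        field_simp
      push_cast
      rw [e1, hypCoef_eq_mul_succ_right]
      ring
  simp_rw [h2] at h1
  exact sub_eq_zero.1 (tendsto_nhds_unique h1 (natCast_mul_hypCoef_tendsto_zero h))

theorem tendsto_inv_poch_add_natCast (c : ℂ) (k : ℕ) :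
    Tendsto (fun N : ℕ => (poch (c + N) k)⁻¹) atTop (𝓝 (if k = 0 then 1 else 0)) := by
  induction k with
  | zero => simp [poch_zero]
  | succ k ih =>
    have h1 : Tendsto (fun N : ℕ => (c + N + k)⁻¹) atTop (𝓝 0) := by
      refine tendsto_inv₀_cobounded.comp ?_
      rw [← tendsto_norm_atTop_iff_cobounded]
      refine tendsto_atTop_mono (f := fun N : ℕ => (N : ℝ) - ‖c + k‖) (fun N => ?_) ?_
      · have := norm_sub_norm_le (N : ℂ) (-(c + k))
        rw [norm_neg, Complex.norm_natCast, sub_neg_eq_add] at this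
        rwa [show c + N + k = N + (c + k) by ring]
      · exact tendsto_atTop_add_const_right _ _ tendsto_natCast_atTop_atTop
    have h2 := ih.mul h1
    simp only [mul_zero] at h2
    simpa [poch_succ, mul_comm] using h2

/-- In the right half-plane each factor grows in modulus when the real part increases at fixed
imaginary part. This supplies the domination for the limit c → ∞ in Gauss's theorem. -/
theorem norm_poch_le_norm_poch {x y : ℂ} (hx : 0 ≤ x.re) (hxy : x.re ≤ y.re) (him : x.im = y.im)
    (k : ℕ) : ‖poch x k‖ ≤ ‖poch y k‖ := by
  induction k with
  | zero => simp [poch_zero]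
  | succ k ih =>
    rw [poch_succ, poch_succ, norm_mul, norm_mul]
    refine mul_le_mul ih ?_ (norm_nonneg _) (norm_nonneg _)
    rw [← sq_le_sq₀ (norm_nonneg _) (norm_nonneg _), Complex.sq_norm, Complex.sq_norm,
      Complex.normSq_apply, Complex.normSq_apply]
    simp only [Complex.add_re, Complex.natCast_re, Complex.add_im, Complex.natCast_im, him]
    have hk : (0 : ℝ) ≤ k := k.cast_nonneg
    nlinarith

/-- After multiplication by Γ(c+N) the k-th term carries 1/(c+N)_k, so in the limit only k = 0
survives. -/
theorem tendsto_Gamma_mul_tsum_hypCoef {a b c : ℂ} (h : 0 < (c - a - b).re) :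
    Tendsto (fun N : ℕ => Complex.Gamma (c + N) * ∑' k, hypCoef a b (c + N) k) atTop
      (𝓝 (Complex.Gamma a * Complex.Gamma b)) := by
  obtain ⟨N₀, hN₀⟩ := exists_nat_gt (-c.re)
  have hpos : ∀ N : ℕ, N₀ ≤ N → 0 < (c + N).re := by
    intro N hN
    have : (N₀ : ℝ) ≤ N := by exact_mod_cast hN
    simp only [Complex.add_re, Complex.natCast_re]
    linarith
  have hterm : ∀ N : ℕ, N₀ ≤ N → ∀ k, Complex.Gamma (c + N) * hypCoef a b (c + N) k
      = Complex.Gamma (a + k) * Complex.Gamma (b + k) / (k ! : ℂ) * (poch (c + N) k)⁻¹ := by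
    intro N hN k
    have hp := ne_neg_natCast_of_re_pos (hpos N hN)
    have := Complex.Gamma_ne_zero hp
    rw [hypCoef, Gamma_add_natCast hp]
    have := poch_ne_zero hp k
    field_simp
  have hN₀s : 0 < (c + N₀ - a - b).re := by
    have : (0 : ℝ) ≤ N₀ := N₀.cast_nonneg
    simp only [Complex.sub_re, Complex.add_re, Complex.natCast_re] at h ⊢
    linarith
  have hsum : Summable fun k : ℕ =>
      ‖Complex.Gamma (a + k) * Complex.Gamma (b + k) / (k ! : ℂ) * (poch (c + N₀) k)⁻¹‖ :=
    (((hypCoef_summable hN₀s).mul_left (Complex.Gamma (c + N₀))).congr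
      (hterm N₀ le_rfl)).norm
  have key := tendsto_tsum_of_dominated_convergence (𝓕 := atTop)
    (f := fun (N : ℕ) (k : ℕ) => Complex.Gamma (a + k) * Complex.Gamma (b + k) / (k ! : ℂ)
      * (poch (c + N) k)⁻¹) hsum
    (fun k => (tendsto_inv_poch_add_natCast c k).const_mul _) (by
      filter_upwards [eventually_ge_atTop N₀] with N hN k
      rw [norm_mul, norm_mul, norm_inv, norm_inv]
      have hN' : (N₀ : ℝ) ≤ N := by exact_mod_cast hN
      have := norm_poch_le_norm_poch (x := c + N₀) (y := c + N) (hpos N₀ le_rfl).le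
        (by simpa using hN') (by simp) k
      have h0 : 0 < ‖poch (c + N₀) k‖ :=
        norm_pos_iff.2 (poch_ne_zero (ne_neg_natCast_of_re_pos (hpos N₀ le_rfl)) k)
      gcongr)
  rw [tsum_eq_single 0 (fun k hk => by simp [hk])] at key
  simp only [Nat.cast_zero, add_zero, Nat.factorial_zero, Nat.cast_one, div_one, if_true,
    mul_one] at key
  refine key.congr' ?_
  filter_upwards [eventually_ge_atTop N₀] with N hN
  rw [← tsum_mul_left]
  exact tsum_congr fun k => (hterm N hN k).symm

/-- Gauss's summation theorem. -/
theorem tsum_hypCoef {a b c : ℂ} (ha : ∀ j : ℕ, a ≠ -(j : ℂ)) (hb : ∀ j : ℕ, b ≠ -(j : ℂ))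
    (hca : ∀ j : ℕ, c - a ≠ -(j : ℂ)) (hcb : ∀ j : ℕ, c - b ≠ -(j : ℂ))
    (h : 0 < (c - a - b).re) :
    ∑' k, hypCoef a b c k = Complex.Gamma (c - a - b) * (Complex.Gamma a * Complex.Gamma b
      * (Complex.Gamma (c - a))⁻¹ * (Complex.Gamma (c - b))⁻¹) := by
  have hcab := ne_neg_natCast_of_re_pos h
  -- The contiguous relation makes this product invariant under c ↦ c + 1; its value is then read
  -- off as N → ∞.
  have hiter : ∀ N : ℕ, (∑' k, hypCoef a b (c + N) k) * (Complex.Gamma (c - a + N)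
      * Complex.Gamma (c - b + N) / Complex.Gamma (c - a - b + N))
      = (∑' k, hypCoef a b c k) * (Complex.Gamma (c - a)
      * Complex.Gamma (c - b) / Complex.Gamma (c - a - b)) := by
    intro N
    induction N with
    | zero => simp
    | succ N ih =>
      rw [← ih, Gamma_add_natCast_succ hca, Gamma_add_natCast_succ hcb,
        Gamma_add_natCast_succ hcab]
      have hN : 0 < (c + N - a - b).re := by
        have : (0 : ℝ) ≤ N := N.cast_nonneg
        simp only [Complex.sub_re, Complex.add_re, Complex.natCast_re] at h ⊢
        linarith
      have h1 := tsum_hypCoef_succ_right ha hb hN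
      have h2 := Complex.Gamma_ne_zero (add_natCast_ne hcab N)
      have h3 := add_natCast_ne_zero hcab N
      have e : c + ((N + 1 : ℕ) : ℂ) = c + N + 1 := by push_cast; ring
      rw [e]
      field_simp
      linear_combination Complex.Gamma (c - a + N) * Complex.Gamma (c - b + N) * h1
  have hlim := tendsto_Gamma_mul_tsum_hypCoef (a := a) (b := b) h
  have hr : Tendsto (fun N : ℕ => Complex.Gamma (c - a + N) * Complex.Gamma (c - b + N)
      / (Complex.Gamma (c - a - b + N) * Complex.Gamma (c + N))) atTop (𝓝 1) := by
    refine (tendsto_add_atTop_iff_nat 1).1 ?_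
    have h4 := (((tendsto_Gamma_div_cpow_mul_factorial (c - a)).mul
      (tendsto_Gamma_div_cpow_mul_factorial (c - b))).div
      ((tendsto_Gamma_div_cpow_mul_factorial (c - a - b)).mul
      (tendsto_Gamma_div_cpow_mul_factorial c)) (by norm_num))
    simp only [mul_one, div_one] at h4
    refine h4.congr' ?_
    filter_upwards [eventually_gt_atTop 0] with n hn
    have hn0' : (n : ℂ) ≠ 0 := by exact_mod_cast hn.ne'
    have hf := factorial_ne_zero_complex n
    have e : ∀ x : ℂ, (n : ℂ) ^ x ≠ 0 := fun x => by simp [Complex.cpow_eq_zero_iff, hn0']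
    have e1 : (n : ℂ) ^ (c - a) * (n : ℂ) ^ (c - b) = (n : ℂ) ^ (c - a - b) * (n : ℂ) ^ c := by
      rw [← Complex.cpow_add _ _ hn0', ← Complex.cpow_add _ _ hn0']
      ring_nf
    rw [Pi.div_apply, div_mul_div_comm, div_mul_div_comm, div_div_div_eq,
      show (n : ℂ) ^ (c - a) * (n ! : ℂ) * ((n : ℂ) ^ (c - b) * (n ! : ℂ))
        = (n : ℂ) ^ (c - a - b) * (n ! : ℂ) * ((n : ℂ) ^ c * (n ! : ℂ)) by
          linear_combination (n ! : ℂ) ^ 2 * e1, mul_comm,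
      mul_div_mul_left _ _ (mul_ne_zero (mul_ne_zero (e _) hf) (mul_ne_zero (e _) hf))]
    push_cast
    simp only [← add_assoc]
  have hprod := hlim.mul hr
  rw [mul_one] at hprod
  have hconst : Tendsto (fun _ : ℕ => (∑' k, hypCoef a b c k) * (Complex.Gamma (c - a)
      * Complex.Gamma (c - b) / Complex.Gamma (c - a - b))) atTop
      (𝓝 (Complex.Gamma a * Complex.Gamma b)) := by
    refine hprod.congr' ?_
    obtain ⟨N₀, hN₀⟩ := exists_nat_gt (-c.re)
    filter_upwards [eventually_ge_atTop N₀] with N hN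
    have hp : 0 < (c + N).re := by
      have : (N₀ : ℝ) ≤ N := by exact_mod_cast hN
      simp only [Complex.add_re, Complex.natCast_re]
      linarith
    have h5 := Complex.Gamma_ne_zero_of_re_pos hp
    have h6 := Complex.Gamma_ne_zero (add_natCast_ne hcab N)
    rw [← hiter N]
    field_simp
  have h7 := tendsto_nhds_unique tendsto_const_nhds hconst
  have g1 := Complex.Gamma_ne_zero hca
  have g2 := Complex.Gamma_ne_zero hcb
  have g3 := Complex.Gamma_ne_zero hcab
  field_simp at h7 ⊢
  linear_combination h7

/-! ### Uniform comparison with 1/(k+1) and the regularized value at 1 -/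

/-- A sequence with limit `1` and relative increments `O(k⁻²)` is within `O(k⁻¹)` of `1`. -/
theorem norm_sub_one_le_of_increment_le {ρ : ℕ → ℂ} {K B : ℝ} {k₀ : ℕ} (hk₀ : 1 ≤ k₀)
    (hK : 0 ≤ K) (hB : ‖ρ k₀‖ ≤ B)
    (hstep : ∀ k, k₀ ≤ k → ‖ρ (k + 1) - ρ k‖ ≤ K / ((k : ℝ) + 1) ^ 2 * ‖ρ k‖)
    (hlim : Tendsto ρ atTop (𝓝 1)) (k : ℕ) (hk : k₀ ≤ k) :
    ‖ρ k - 1‖ ≤ B * Real.exp K * K / k := by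
  have hB0 : 0 ≤ B := (norm_nonneg _).trans hB
  have hfrac : ∀ j : ℕ, k₀ ≤ j →
      -- Comparison with a telescoping difference: it bounds both the product of the factors 1 +
      -- K/(j+1)² and the tail of the increments.
      K / ((j : ℝ) + 1) ^ 2 ≤ K * (1 / (j : ℝ) - 1 / ((j : ℝ) + 1)) := by
    intro j hj
    have hj0 : (0 : ℝ) < j := by exact_mod_cast (by omega : 0 < j)
    have e : 1 / (j : ℝ) - 1 / ((j : ℝ) + 1) = 1 / ((j : ℝ) * (j + 1)) := by
      field_simp
      ring
    rw [e, div_eq_mul_one_div]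
    gcongr
    nlinarith
  have hbd : ∀ j : ℕ, k₀ ≤ j → ‖ρ j‖ ≤ B * Real.exp (K * (1 - 1 / (j : ℝ))) := by
    intro j hj
    induction j, hj using Nat.le_induction with
    | base =>
      refine hB.trans (le_mul_of_one_le_right hB0 (Real.one_le_exp (mul_nonneg hK ?_)))
      have : (1 : ℝ) ≤ k₀ := by exact_mod_cast hk₀
      have := div_le_one_of_le₀ this (by positivity)
      linarith
    | succ j hj ih =>
      have h1 : ‖ρ (j + 1)‖ ≤ (1 + K / ((j : ℝ) + 1) ^ 2) * ‖ρ j‖ := by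
        have := norm_add_le (ρ (j + 1) - ρ j) (ρ j)
        rw [sub_add_cancel] at this
        linarith [hstep j hj]
      have h2 : 1 + K / ((j : ℝ) + 1) ^ 2
          ≤ Real.exp (K * (1 / (j : ℝ) - 1 / ((j : ℝ) + 1))) := by
        have := Real.add_one_le_exp (K * (1 / (j : ℝ) - 1 / ((j : ℝ) + 1)))
        linarith [hfrac j hj]
      calc ‖ρ (j + 1)‖ ≤ (1 + K / ((j : ℝ) + 1) ^ 2) * ‖ρ j‖ := h1
        _ ≤ Real.exp (K * (1 / (j : ℝ) - 1 / ((j : ℝ) + 1)))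
            * (B * Real.exp (K * (1 - 1 / (j : ℝ)))) := by gcongr
        _ = B * (Real.exp (K * (1 / (j : ℝ) - 1 / ((j : ℝ) + 1)))
            * Real.exp (K * (1 - 1 / (j : ℝ)))) := by ring
        _ = _ := by
          rw [← Real.exp_add]
          push_cast
          ring_nf
  have hbd' : ∀ j : ℕ, k₀ ≤ j → ‖ρ j‖ ≤ B * Real.exp K := by
    intro j hj
    refine (hbd j hj).trans ?_
    gcongr
    have : (0 : ℝ) ≤ 1 / j := by positivity
    nlinarith
  have htail : ∀ N : ℕ, k ≤ N →
      ‖ρ k - ρ N‖ ≤ B * Real.exp K * K * (1 / (k : ℝ) - 1 / (N : ℝ)) := by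
    intro N hN
    induction N, hN using Nat.le_induction with
    | base => simp
    | succ N hN ih =>
      have h1 := norm_add_le (ρ k - ρ N) (ρ N - ρ (N + 1))
      rw [sub_add_sub_cancel, norm_sub_rev (ρ N)] at h1
      have h2 : ‖ρ (N + 1) - ρ N‖
          ≤ K * (1 / (N : ℝ) - 1 / ((N : ℝ) + 1)) * (B * Real.exp K) :=
        (hstep N (hk.trans hN)).trans (mul_le_mul (hfrac N (hk.trans hN))
          (hbd' N (hk.trans hN)) (norm_nonneg _) (le_trans (by positivity)
            (hfrac N (hk.trans hN))))
      push_cast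
      linarith
  have h3 : Tendsto (fun N => ‖ρ k - ρ N‖) atTop (𝓝 ‖ρ k - 1‖) :=
    (tendsto_const_nhds.sub hlim).norm
  refine le_of_tendsto h3 ?_
  filter_upwards [eventually_ge_atTop k] with N hN
  have h4 : 0 ≤ B * Real.exp K * K := by positivity
  have h5 : (0 : ℝ) ≤ 1 / N := by positivity
  calc _ ≤ _ := htail N hN
    _ ≤ B * Real.exp K * K * (1 / k) := mul_le_mul_of_nonneg_left (by linarith) h4
    _ = _ := by ring

theorem hypCoef_one_one (c : ℂ) (k : ℕ) :
    hypCoef 1 1 c k = (k ! : ℂ) * (Complex.Gamma (c + k))⁻¹ := by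
  have hf := factorial_ne_zero_complex k
  rw [hypCoef, add_comm 1 (k : ℂ), Complex.Gamma_nat_eq_factorial]
  field_simp

/-- The case a = b = 1, c = 2 is the reference sequence: its generating function is -log(1 - z)/z.
-/
theorem hypCoef_one_one_two (k : ℕ) : hypCoef 1 1 2 k = 1 / ((k : ℂ) + 1) := by
  have hf := factorial_ne_zero_complex k
  have hk := natCast_add_one_ne_zero k
  rw [hypCoef_one_one, show (2 : ℂ) + k = ((k + 1 : ℕ) : ℂ) + 1 by push_cast; ring,
    Complex.Gamma_nat_eq_factorial, factorial_succ_complex]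
  field_simp

theorem two_add_re_pos {ε : ℝ} (hε : 0 ≤ ε) : 0 < ((2 : ℂ) + ε).re := by
  simp only [Complex.add_re, Complex.re_ofNat, Complex.ofReal_re]
  linarith

theorem hypCoef_one_one_ne_zero {ε : ℝ} (hε : 0 ≤ ε) (k : ℕ) : hypCoef 1 1 (2 + ε) k ≠ 0 := by
  rw [hypCoef_one_one]
  exact mul_ne_zero (factorial_ne_zero_complex k) (inv_ne_zero (Complex.Gamma_ne_zero
    (add_natCast_ne (ne_neg_natCast_of_re_pos (two_add_re_pos hε)) k)))

/-- The quantity (k+1)‖U_k‖ is nonincreasing, because U_{k+1}/U_k = (k+1)/(k+2+ε) and ε ≥ 0. -/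
theorem norm_hypCoef_one_one_le {ε : ℝ} (hε : 0 ≤ ε) (k : ℕ) :
    ‖hypCoef 1 1 (2 + ε) k‖ ≤ ‖(Complex.Gamma (2 + ε))⁻¹‖ / ((k : ℝ) + 1) := by
  induction k with
  | zero => simp [hypCoef_one_one]
  | succ k ih =>
    have h1 := hypCoef_succ_mul (a := 1) (b := 1) (by simpa using ne_neg_natCast_of_re_pos (a := 1))
      (by simpa using ne_neg_natCast_of_re_pos (a := 1)) (2 + ε) k
    have hk := natCast_add_one_ne_zero k
    have h2 : (2 + ε + k) * hypCoef 1 1 (2 + ε) (k + 1) = (k + 1) * hypCoef 1 1 (2 + ε) k := by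
      apply mul_left_cancel₀ hk
      linear_combination h1
    have h3 : ‖(2 : ℂ) + ε + k‖ = 2 + ε + k := by
      rw [show (2 : ℂ) + ε + k = ((2 + ε + k : ℝ) : ℂ) by push_cast; rfl, Complex.norm_real,
        Real.norm_of_nonneg (by positivity)]
    have h4 : ‖(k : ℂ) + 1‖ = k + 1 := by
      rw [show (k : ℂ) + 1 = ((k + 1 : ℝ) : ℂ) by push_cast; rfl, Complex.norm_real,
        Real.norm_of_nonneg (by positivity)]
    have h5 := congrArg norm h2
    rw [norm_mul, norm_mul, h3, h4] at h5
    push_cast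
    rw [le_div_iff₀ (by positivity)] at ih ⊢
    calc ‖hypCoef 1 1 (2 + ε) (k + 1)‖ * ((k : ℝ) + 1 + 1)
        ≤ ‖hypCoef 1 1 (2 + ε) (k + 1)‖ * (2 + ε + k) :=
          mul_le_mul_of_nonneg_left (by linarith) (norm_nonneg _)
      _ = ‖hypCoef 1 1 (2 + ε) k‖ * (k + 1) := by linarith
      _ ≤ _ := ih

/-- The quotient of two zero-balanced coefficient sequences tends to `1`. -/
theorem tendsto_hypCoef_div (a b : ℂ) (ε : ℝ) :
    Tendsto (fun k => hypCoef a b (a + b + ε) k / hypCoef 1 1 (2 + ε) k) atTop (𝓝 1) := by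
  refine (tendsto_add_atTop_iff_nat 1).1 ?_
  have h := (hypCoef_tendsto a b (a + b + ε)).div (hypCoef_tendsto 1 1 (2 + ε)) one_ne_zero
  rw [div_one] at h
  refine h.congr' ?_
  filter_upwards [eventually_gt_atTop 0] with n hn
  have hn0' : (n : ℂ) ≠ 0 := by exact_mod_cast hn.ne'
  rw [Pi.div_apply, show a + b - (a + b + ε) - 1 = -ε - 1 by ring,
    show (1 : ℂ) + 1 - (2 + ε) - 1 = -ε - 1 by ring]
  exact div_div_div_cancel_right₀ (by simp [Complex.cpow_eq_zero_iff, hn0']) _ _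

/-- The ratio of consecutive quotients is (a+k)(b+k)(2+ε+k)/((a+b+ε+k)(k+1)²). Numerator and
denominator agree in the k³ and k² terms because both sequences have the same excess ε, so the ratio
is 1 + O(k⁻²). The lower bound on k gives |a+b+ε+k| ≥ (k+1)/2. -/
theorem norm_hypCoef_div_increment_le {a b : ℂ} (ha : ∀ j : ℕ, a ≠ -(j : ℂ))
    (hb : ∀ j : ℕ, b ≠ -(j : ℂ)) {ε : ℝ} (h0 : 0 ≤ ε) (h1 : ε ≤ 1) {k : ℕ}
    (hk : 2 * ‖a + b‖ + 1 ≤ k) :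
    ‖hypCoef a b (a + b + ε) (k + 1) / hypCoef 1 1 (2 + ε) (k + 1)
      - hypCoef a b (a + b + ε) k / hypCoef 1 1 (2 + ε) k‖
    ≤ 2 * (3 * ‖a * b‖ + ‖a + b‖ + 3) / ((k : ℝ) + 1) ^ 2
      * ‖hypCoef a b (a + b + ε) k / hypCoef 1 1 (2 + ε) k‖ := by
  set T := hypCoef a b (a + b + ε)
  set U := hypCoef 1 1 (2 + ε)
  have hU : ∀ k, U k ≠ 0 := fun k => hypCoef_one_one_ne_zero h0 k
  have hk1 := natCast_add_one_ne_zero k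
  have e1 : (a + b + ε + k) * ((k + 1) * T (k + 1)) = (a + k) * (b + k) * T k :=
    hypCoef_succ_mul ha hb _ k
  have e2 : (2 + ε + k) * ((k + 1) * U (k + 1)) = (1 + k) * (1 + k) * U k :=
    hypCoef_succ_mul (by simpa using ne_neg_natCast_of_re_pos (a := 1))
      (by simpa using ne_neg_natCast_of_re_pos (a := 1)) _ k
  have hden : ((k : ℝ) + 1) / 2 ≤ ‖a + b + ε + k‖ := by
    have h2 := norm_sub_norm_le ((ε : ℂ) + k) (-(a + b))
    rw [norm_neg, sub_neg_eq_add, show (ε : ℂ) + k = ((ε + k : ℝ) : ℂ) by push_cast; rfl,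
      Complex.norm_real, Real.norm_of_nonneg (by positivity)] at h2
    rw [show a + b + ε + k = ((ε + k : ℝ) : ℂ) + (a + b) by push_cast; ring]
    linarith
  have hden0 : a + b + ε + k ≠ 0 := by
    rw [← norm_pos_iff]
    exact lt_of_lt_of_le (by positivity) hden
  have e3 : T (k + 1) / U (k + 1) - T k / U k
      = ((k : ℂ) * (a * b - 1 + (a + b) * ε - 2 * ε) + (a * b * (2 + ε) - (a + b) - ε))
        / ((a + b + ε + k) * (k + 1) ^ 2) * (T k / U k) := by
    have hUk := hU k
    have hUk1 := hU (k + 1)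
    have e4 : T (k + 1) / U (k + 1)
        = (a + k) * (b + k) * (2 + ε + k) / ((a + b + ε + k) * (k + 1) ^ 2) * (T k / U k) := by
      rw [div_eq_iff hUk1]
      field_simp
      apply mul_left_cancel₀ hk1
      linear_combination (k + 1) ^ 2 * U k * e1 - (a + k) * (b + k) * T k * e2
    rw [e4]
    field_simp
    ring
  have hε : ‖(ε : ℂ)‖ ≤ 1 := by
    rw [Complex.norm_real, Real.norm_of_nonneg h0]
    exact h1
  have hnum : ‖(k : ℂ) * (a * b - 1 + (a + b) * ε - 2 * ε) + (a * b * (2 + ε) - (a + b) - ε)‖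
      ≤ (3 * ‖a * b‖ + ‖a + b‖ + 3) * ((k : ℝ) + 1) := by
    have n1 : ‖a * b - 1 + (a + b) * ε - 2 * ε‖ ≤ 3 * ‖a * b‖ + ‖a + b‖ + 3 := by
      calc ‖a * b - 1 + (a + b) * ε - 2 * ε‖
          ≤ ‖a * b‖ + ‖(1 : ℂ)‖ + ‖(a + b) * ε‖ + ‖2 * (ε : ℂ)‖ :=
            (norm_sub_le _ _).trans (add_le_add_left ((norm_add_le _ _).trans
              (add_le_add_left (norm_sub_le _ _) _)) _)
        _ ≤ ‖a * b‖ + 1 + ‖a + b‖ * 1 + 2 * 1 := by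
            rw [norm_mul (a + b), norm_mul (2 : ℂ), norm_one, RCLike.norm_ofNat]
            gcongr
        _ ≤ _ := by linarith [norm_nonneg (a * b)]
    have n2 : ‖a * b * (2 + ε) - (a + b) - ε‖ ≤ 3 * ‖a * b‖ + ‖a + b‖ + 3 := by
      calc ‖a * b * (2 + ε) - (a + b) - ε‖
          ≤ ‖a * b * (2 + ε)‖ + ‖a + b‖ + ‖(ε : ℂ)‖ :=
            (norm_sub_le _ _).trans (add_le_add_left (norm_sub_le _ _) _)
        _ ≤ ‖a * b‖ * (2 + 1) + ‖a + b‖ + 1 := by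
            rw [norm_mul (a * b)]
            gcongr
            refine (norm_add_le _ _).trans ?_
            rw [RCLike.norm_ofNat]
            gcongr
        _ ≤ _ := by linarith [norm_nonneg (a * b)]
    refine (norm_add_le _ _).trans ?_
    rw [norm_mul, Complex.norm_natCast]
    have : (0 : ℝ) ≤ k := k.cast_nonneg
    nlinarith
  rw [e3, norm_mul]
  gcongr
  rw [norm_div, norm_mul, norm_pow, show ‖(k : ℂ) + 1‖ = k + 1 by
    rw [show (k : ℂ) + 1 = ((k + 1 : ℝ) : ℂ) by push_cast; rfl, Complex.norm_real,
      Real.norm_of_nonneg (by positivity)]]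
  rw [div_le_div_iff₀ (by positivity) (by positivity)]
  have hX : 0 ≤ 3 * ‖a * b‖ + ‖a + b‖ + 3 := by positivity
  calc _ ≤ (3 * ‖a * b‖ + ‖a + b‖ + 3) * ((k : ℝ) + 1) * ((k : ℝ) + 1) ^ 2 := by gcongr
    _ = 2 * (3 * ‖a * b‖ + ‖a + b‖ + 3) * (((k : ℝ) + 1) / 2 * ((k : ℝ) + 1) ^ 2) := by ring
    _ ≤ _ := by gcongr

theorem continuous_hypCoef (a b : ℂ) (s : ℂ) (k : ℕ) :
    Continuous fun ε : ℝ => hypCoef a b (s + ε) k := by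
  have : Continuous fun c : ℂ => (Complex.Gamma c)⁻¹ :=
    Complex.differentiable_one_div_Gamma.continuous
  have h2 : Continuous fun ε : ℝ => (Complex.Gamma (s + ε + k))⁻¹ :=
    this.comp (by fun_prop)
  unfold hypCoef
  fun_prop

/-- Two zero-balanced coefficient sequences differ by `O(k⁻²)`, uniformly in the excess. -/
theorem exists_norm_hypCoef_sub_le {a b : ℂ} (ha : ∀ j : ℕ, a ≠ -(j : ℂ))
    (hb : ∀ j : ℕ, b ≠ -(j : ℂ)) :
    ∃ K : ℝ, ∀ᶠ ε : ℝ in 𝓝[≥] (0 : ℝ), ∀ k : ℕ,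
      ‖hypCoef a b (a + b + ε) k - hypCoef 1 1 (2 + ε) k‖ ≤ K / ((k : ℝ) + 1) ^ 2 := by
  obtain ⟨k₀, hk₀⟩ := exists_nat_gt (2 * ‖a + b‖ + 1)
  have hk₀1 : 1 ≤ k₀ := by
    have : (1 : ℝ) ≤ k₀ := by linarith [norm_nonneg (a + b)]
    exact_mod_cast this
  set K₁ := 2 * (3 * ‖a * b‖ + ‖a + b‖ + 3) with hK₁
  have hK₁0 : 0 ≤ K₁ := by positivity
  set B := ‖hypCoef a b (a + b + (0 : ℝ)) k₀ / hypCoef 1 1 (2 + (0 : ℝ)) k₀‖ + 1 with hBdef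
  set G := ‖(Complex.Gamma (2 + (0 : ℝ)))⁻¹‖ + 1 with hG
  set D : ℕ → ℝ := fun k =>
    ‖hypCoef a b (a + b + (0 : ℝ)) k - hypCoef 1 1 (2 + (0 : ℝ)) k‖ + 1 with hD
  set K₂ := B * Real.exp K₁ * K₁ with hK₂
  have hB0 : 0 ≤ B := by positivity
  have hK₂0 : 0 ≤ K₂ := by positivity
  -- The first summand serves k ≥ k₀, its 2 coming from 1/k ≤ 2/(k+1). The finite sum serves k < k₀,
  -- where continuity in ε is enough. The filter includes ε = 0, which is needed later.
  refine ⟨2 * G * K₂ + ∑ k ∈ Finset.range k₀, D k * ((k : ℝ) + 1) ^ 2, ?_⟩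
  have hsum0 : 0 ≤ ∑ k ∈ Finset.range k₀, D k * ((k : ℝ) + 1) ^ 2 :=
    Finset.sum_nonneg fun k _ => by positivity
  have ev1 : ∀ᶠ ε : ℝ in 𝓝[≥] (0 : ℝ),
      ‖hypCoef a b (a + b + ε) k₀ / hypCoef 1 1 (2 + ε) k₀‖ ≤ B := by
    have hc : ContinuousAt (fun ε : ℝ => hypCoef a b (a + b + ε) k₀ / hypCoef 1 1 (2 + ε) k₀) 0 :=
      (continuous_hypCoef a b _ k₀).continuousAt.div (continuous_hypCoef 1 1 _ k₀).continuousAt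
        (hypCoef_one_one_ne_zero le_rfl k₀)
    have := (hc.norm.tendsto.mono_left nhdsWithin_le_nhds).eventually_lt_const
      (lt_add_one _) (l := 𝓝[≥] (0 : ℝ))
    exact this.mono fun ε h => h.le
  have ev2 : ∀ᶠ ε : ℝ in 𝓝[≥] (0 : ℝ), ‖(Complex.Gamma (2 + (ε : ℂ)))⁻¹‖ ≤ G := by
    have hc : Continuous fun ε : ℝ => (Complex.Gamma (2 + (ε : ℂ)))⁻¹ :=
      Complex.differentiable_one_div_Gamma.continuous.comp (by fun_prop)
    have := (hc.continuousAt.norm.tendsto.mono_left nhdsWithin_le_nhds).eventually_lt_const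
      (lt_add_one _) (l := 𝓝[≥] (0 : ℝ))
    exact this.mono fun ε h => h.le
  have ev3 : ∀ᶠ ε : ℝ in 𝓝[≥] (0 : ℝ), ∀ k ∈ Finset.range k₀,
      ‖hypCoef a b (a + b + ε) k - hypCoef 1 1 (2 + ε) k‖ ≤ D k := by
    refine (Finset.eventually_all _).2 fun k _ => ?_
    have hc : Continuous fun ε : ℝ => hypCoef a b (a + b + ε) k - hypCoef 1 1 (2 + ε) k :=
      (continuous_hypCoef a b _ k).sub (continuous_hypCoef 1 1 _ k)
    have := (hc.continuousAt.norm.tendsto.mono_left nhdsWithin_le_nhds).eventually_lt_const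
      (lt_add_one _) (l := 𝓝[≥] (0 : ℝ))
    exact this.mono fun ε h => h.le
  have ev4 : ∀ᶠ ε : ℝ in 𝓝[≥] (0 : ℝ), ε ≤ 1 :=
    nhdsWithin_le_nhds (Iic_mem_nhds one_pos)
  filter_upwards [ev1, ev2, ev3, ev4, self_mem_nhdsWithin] with ε h1 h2 h3 h4 h0 k
  have h0 : 0 ≤ ε := h0
  rw [le_div_iff₀ (by positivity)]
  rcases lt_or_ge k k₀ with hk | hk
  · have hm := Finset.mem_range.2 hk
    calc _ ≤ D k * ((k : ℝ) + 1) ^ 2 := by gcongr; exact h3 k hm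
      _ ≤ ∑ k ∈ Finset.range k₀, D k * ((k : ℝ) + 1) ^ 2 :=
        Finset.single_le_sum (f := fun k : ℕ => D k * ((k : ℝ) + 1) ^ 2)
          (fun k _ => by positivity) hm
      _ ≤ _ := by
        have : 0 ≤ 2 * G * K₂ := by positivity
        linarith
  · have hρ := norm_sub_one_le_of_increment_le
      (ρ := fun k => hypCoef a b (a + b + ε) k / hypCoef 1 1 (2 + ε) k) hk₀1 hK₁0 h1
      (fun j hj => norm_hypCoef_div_increment_le ha hb h0 h4 (by
        have : (k₀ : ℝ) ≤ j := by exact_mod_cast hj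
        linarith)) (tendsto_hypCoef_div a b ε) k hk
    have hU := hypCoef_one_one_ne_zero h0 k
    have hUn := norm_hypCoef_one_one_le h0 k
    have hk1 : (1 : ℝ) ≤ k := by exact_mod_cast hk₀1.trans hk
    have e : hypCoef a b (a + b + ε) k - hypCoef 1 1 (2 + ε) k
        = (hypCoef a b (a + b + ε) k / hypCoef 1 1 (2 + ε) k - 1) * hypCoef 1 1 (2 + ε) k := by
      field_simp
    have hk2 : K₂ / k ≤ 2 * K₂ / (k + 1) := by
      rw [div_le_div_iff₀ (by positivity) (by positivity)]
      nlinarith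
    rw [e, norm_mul]
    calc _ ≤ (2 * K₂ / ((k : ℝ) + 1)) * (G / ((k : ℝ) + 1)) * ((k : ℝ) + 1) ^ 2 := by
          gcongr
          · exact hρ.trans hk2
          · exact hUn.trans (by gcongr)
      _ = 2 * G * K₂ := by field_simp
      _ ≤ _ := by linarith

theorem hasDerivAt_inv_Gamma {a : ℂ} (ha : ∀ j : ℕ, a ≠ -(j : ℂ)) :
    HasDerivAt (fun x : ℂ => (Complex.Gamma (a + x))⁻¹)
      (-Complex.digamma a * (Complex.Gamma a)⁻¹) 0 := by
  have hG := Complex.Gamma_ne_zero ha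
  have h1 : HasDerivAt Complex.Gamma (deriv Complex.Gamma (a + 0)) (a + 0) := by
    rw [add_zero]
    exact (Complex.differentiableAt_Gamma a ha).hasDerivAt
  have h2 := (h1.comp_const_add a 0).inv (by simpa using hG)
  refine h2.congr_deriv ?_
  rw [Complex.digamma_def, logDeriv_apply, add_zero]
  field_simp

theorem tsum_hypCoef_sub_excess {a b : ℂ} (ha : ∀ j : ℕ, a ≠ -(j : ℂ))
    (hb : ∀ j : ℕ, b ≠ -(j : ℂ)) {ε : ℝ} (hε : 0 < ε) (ha' : ∀ j : ℕ, a + ε ≠ -(j : ℂ))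
    (hb' : ∀ j : ℕ, b + ε ≠ -(j : ℂ)) :
    ∑' k, hypCoef a b (a + b + ε) k = Complex.Gamma ε * (Complex.Gamma a * Complex.Gamma b
      * (Complex.Gamma (b + ε))⁻¹ * (Complex.Gamma (a + ε))⁻¹) := by
  have e1 : a + b + ε - a = b + ε := by ring
  have e2 : a + b + ε - b = a + ε := by ring
  have e3 : a + b + ε - a - b = ε := by ring
  rw [tsum_hypCoef ha hb (by rwa [e1]) (by rwa [e2]) (by rw [e3]; simpa using hε), e1, e2]
  ring_nf

/-- The regularized value at `1` of the zero-balanced hypergeometric series. -/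
theorem tsum_hypCoef_zero_balanced {a b : ℂ} (ha : ∀ j : ℕ, a ≠ -(j : ℂ))
    (hb : ∀ j : ℕ, b ≠ -(j : ℂ)) :
    ∑' k, (hypCoef a b (a + b) k - 1 / ((k : ℂ) + 1))
      = 2 * Complex.digamma 1 - Complex.digamma a - Complex.digamma b := by
  have h1 : ∀ j : ℕ, (1 : ℂ) ≠ -(j : ℂ) := by simpa using ne_neg_natCast_of_re_pos (a := 1)
  obtain ⟨K, hK⟩ := exists_norm_hypCoef_sub_le ha hb
  have hsumm : Summable fun k : ℕ => K / ((k : ℝ) + 1) ^ 2 := by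
    have := (summable_nat_add_iff 1).2 (Real.summable_one_div_nat_pow.2 (by norm_num : 1 < 2))
    simpa [div_eq_mul_inv] using this.mul_left K
  have hlim1 : Tendsto (fun ε : ℝ => ∑' k, (hypCoef a b (a + b + ε) k - hypCoef 1 1 (2 + ε) k))
      (𝓝[>] 0) (𝓝 (∑' k, (hypCoef a b (a + b) k - 1 / ((k : ℂ) + 1)))) := by
    refine tendsto_tsum_of_dominated_convergence hsumm (fun k => ?_)
      (hK.filter_mono (nhdsWithin_mono _ Set.Ioi_subset_Ici_self))
    have hc : Continuous fun ε : ℝ => hypCoef a b (a + b + ε) k - hypCoef 1 1 (2 + ε) k :=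
      (continuous_hypCoef a b _ k).sub (continuous_hypCoef 1 1 _ k)
    have := (hc.tendsto 0).mono_left (nhdsWithin_le_nhds (s := Set.Ioi 0))
    rw [Complex.ofReal_zero, add_zero, add_zero, hypCoef_one_one_two] at this
    exact this
  have hga := Complex.Gamma_ne_zero ha
  have hgb := Complex.Gamma_ne_zero hb
  -- With Γ(ε) = Γ(ε+1)/ε, the difference of the two Gauss sums is Γ(ε+1) times a difference
  -- quotient at 0 of this function; the poles cancel and the derivative produces the digamma
  -- values.
  have hder := (((hasDerivAt_inv_Gamma hb).const_mul (Complex.Gamma a * Complex.Gamma b)).mul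
    (hasDerivAt_inv_Gamma ha)).sub ((hasDerivAt_inv_Gamma h1).mul (hasDerivAt_inv_Gamma h1))
  have hslope := hder.tendsto_slope_zero
  have hreal : Tendsto (fun ε : ℝ => (ε : ℂ)) (𝓝[>] 0) (𝓝[≠] 0) := by
    refine tendsto_nhdsWithin_iff.2 ⟨?_, ?_⟩
    · have := (Complex.continuous_ofReal.tendsto 0).mono_left
        (nhdsWithin_le_nhds (s := Set.Ioi 0))
      simpa using this
    · filter_upwards [self_mem_nhdsWithin] with ε hε
      have : 0 < ε := hε
      simpa using this.ne'
  have hG1 : Tendsto (fun ε : ℝ => Complex.Gamma (ε + 1)) (𝓝[>] 0) (𝓝 1) := by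
    have hc : ContinuousAt (fun ε : ℝ => Complex.Gamma (ε + 1)) 0 := by
      have : ContinuousAt Complex.Gamma (((0 : ℝ) : ℂ) + 1) :=
        (Complex.differentiableAt_Gamma _ (by simpa using h1)).continuousAt
      exact this.comp (f := fun ε : ℝ => (ε : ℂ) + 1) (by fun_prop)
    have := hc.tendsto.mono_left (nhdsWithin_le_nhds (s := Set.Ioi 0))
    simpa using this
  have hlim2 := hG1.mul (hslope.comp hreal)
  -- `Complex.Gamma` has the default value 0 at its poles, so nonvanishing of the continuous
  -- function 1/Γ keeps c + ε off them for small ε.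
  have hne : ∀ c : ℂ, (∀ j : ℕ, c ≠ -(j : ℂ)) →
      ∀ᶠ ε : ℝ in 𝓝[>] (0 : ℝ), ∀ j : ℕ, c + (ε : ℂ) ≠ -(j : ℂ) := by
    intro c hc
    have hcont : Continuous fun ε : ℝ => (Complex.Gamma (c + (ε : ℂ)))⁻¹ :=
      Complex.differentiable_one_div_Gamma.continuous.comp (by fun_prop)
    have h := (hcont.tendsto 0).mono_left (nhdsWithin_le_nhds (s := Set.Ioi 0))
    have h2 := h.eventually_ne (b₂ := 0) (by simpa using Complex.Gamma_ne_zero hc)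
    filter_upwards [h2] with ε hε j hj
    apply hε
    rw [hj, Complex.Gamma_neg_nat_eq_zero, inv_zero]
  refine tendsto_nhds_unique hlim1 ((hlim2.congr' ?_).trans (le_of_eq (congrArg 𝓝 ?_)))
  · filter_upwards [hne a ha, hne b hb, hne 1 h1, self_mem_nhdsWithin] with ε ha' hb' h1' hε
    have hε : 0 < ε := hε
    have hε0 : (ε : ℂ) ≠ 0 := by simpa using hε.ne'
    have s1 : Summable (hypCoef a b (a + b + ε)) :=
      hypCoef_summable (by rw [show a + b + ε - a - b = (ε : ℂ) by ring]; simpa using hε)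
    have s2 : Summable (hypCoef 1 1 (2 + ε)) :=
      hypCoef_summable (by rw [show (2 : ℂ) + ε - 1 - 1 = (ε : ℂ) by ring]; simpa using hε)
    rw [s1.tsum_sub s2, tsum_hypCoef_sub_excess ha hb hε ha' hb',
      show (2 : ℂ) + ε = 1 + 1 + ε by ring, tsum_hypCoef_sub_excess h1 h1 hε h1' h1',
      Complex.Gamma_add_one _ hε0]
    simp only [Function.comp_apply, zero_add, add_zero, Complex.Gamma_one, inv_one, smul_eq_mul,
      Pi.mul_apply, Pi.sub_apply]
    field_simp
    ring
  · simp only [add_zero, Complex.Gamma_one, inv_one]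
    field_simp
    ring

theorem succ_mul_hypCoef_succ {a b : ℂ} (ha : ∀ j : ℕ, a ≠ -(j : ℂ)) (hb : ∀ j : ℕ, b ≠ -(j : ℂ))
    (c : ℂ) (k : ℕ) :
    ((k : ℂ) + 1) * hypCoef a b c (k + 1) = (a + k) * (b + k) * hypCoef a b (c + 1) k := by
  have hN := natCast_add_one_ne_zero k
  have hf := factorial_ne_zero_complex k
  rw [hypCoef, hypCoef, Gamma_add_natCast_succ ha, Gamma_add_natCast_succ hb,
    factorial_succ_complex]
  push_cast
  rw [show c + (k + 1) = c + 1 + k by ring]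
  field_simp

/-! ### Coefficients of the logarithmic solution -/

/-- The coefficients of the series multiplying the logarithm. -/
noncomputable def logCoef (a b : ℂ) (M k : ℕ) : ℂ :=
  poch a k * poch b k / (((k + M)! : ℂ) * (k ! : ℂ))

/-- The digamma combination in the logarithmic case. -/
noncomputable def digammaSum (a b : ℂ) (M k : ℕ) : ℂ :=
  Complex.digamma (a + k) + Complex.digamma (b + k) - Complex.digamma (k + 1)
    - Complex.digamma (k + M + 1)

/-- The coefficients of the series without logarithm. -/
noncomputable def psiCoef (a b : ℂ) (M k : ℕ) : ℂ := logCoef a b M k * digammaSum a b M k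

theorem natCast_add_natCast_add_one_ne_zero (k M : ℕ) : (k : ℂ) + M + 1 ≠ 0 := by
  exact_mod_cast (k + M).succ_ne_zero

theorem logCoef_succ (a b : ℂ) (M k : ℕ) :
    ((k : ℂ) + 1) * logCoef a b M (k + 1)
      = (a + k) * (b + k) / (k + M + 1) * logCoef a b M k := by
  have h1 := natCast_add_one_ne_zero k
  have h2 := natCast_add_natCast_add_one_ne_zero k M
  have h3 := factorial_ne_zero_complex k
  have h4 := factorial_ne_zero_complex (k + M)
  rw [logCoef, logCoef, poch_succ, poch_succ, show k + 1 + M = (k + M) + 1 by ring,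
    factorial_succ_complex, factorial_succ_complex]
  push_cast
  field_simp

theorem logCoef_ne_zero {a b : ℂ} (ha : ∀ j : ℕ, a ≠ -(j : ℂ)) (hb : ∀ j : ℕ, b ≠ -(j : ℂ))
    (M k : ℕ) : logCoef a b M k ≠ 0 :=
  div_ne_zero (mul_ne_zero (poch_ne_zero ha k) (poch_ne_zero hb k))
    (mul_ne_zero (factorial_ne_zero_complex _) (factorial_ne_zero_complex _))

theorem digamma_add_natCast_succ {a : ℂ} (ha : ∀ j : ℕ, a ≠ -(j : ℂ)) (k : ℕ) :
    Complex.digamma (a + (k + 1 : ℕ)) = Complex.digamma (a + k) + 1 / (a + k) := by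
  rw [one_div, ← Complex.digamma_apply_add_one _ (add_natCast_ne ha k)]
  push_cast
  ring_nf

theorem digammaSum_succ {a b : ℂ} (ha : ∀ j : ℕ, a ≠ -(j : ℂ)) (hb : ∀ j : ℕ, b ≠ -(j : ℂ))
    (M k : ℕ) :
    digammaSum a b M (k + 1) = digammaSum a b M k + 1 / (a + k) + 1 / (b + k) - 1 / (k + 1)
      - 1 / (k + M + 1) := by
  have h1 := digamma_add_natCast_succ (a := 1)
    (by simpa using ne_neg_natCast_of_re_pos (a := 1)) k
  have h2 := digamma_add_natCast_succ (a := 1)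
    (by simpa using ne_neg_natCast_of_re_pos (a := 1)) (k + M)
  rw [digammaSum, digammaSum, digamma_add_natCast_succ ha, digamma_add_natCast_succ hb]
  push_cast at h1 h2 ⊢
  rw [show (k : ℂ) + 1 + 1 = 1 + (k + 1) by ring, h1,
    show (k : ℂ) + 1 + M + 1 = 1 + (k + M + 1) by ring, h2,
    show (1 : ℂ) + k = k + 1 by ring, show (1 : ℂ) + (k + M) = k + M + 1 by ring]
  ring

theorem digammaSum_succ_left {a b : ℂ} (M k : ℕ) :
    digammaSum a b (M + 1) k = digammaSum a b M k - 1 / (k + M + 1) := by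
  have h2 := digamma_add_natCast_succ (a := 1)
    (by simpa using ne_neg_natCast_of_re_pos (a := 1)) (k + M)
  rw [digammaSum, digammaSum]
  push_cast at h2 ⊢
  rw [show (k : ℂ) + (M + 1) + 1 = 1 + (k + M + 1) by ring, h2,
    show (1 : ℂ) + (k + M) = k + M + 1 by ring]
  ring

theorem tendsto_norm_add_div_add (x y : ℂ) :
    Tendsto (fun k : ℕ => (x + k) / ((k : ℂ) + y)) atTop (𝓝 1) := by
  have h1 : Tendsto (fun k : ℕ => (k : ℂ) / (k + y)) atTop (𝓝 1) :=
    tendsto_natCast_div_add_atTop y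
  have h2 : Tendsto (fun k : ℕ => x / (k + y)) atTop (𝓝 0) := by
    have h := (tendsto_inv_poch_add_natCast y 1).const_mul x
    simpa [poch_succ, poch_zero, div_eq_mul_inv, add_comm] using h
  have := h2.add h1
  rw [zero_add] at this
  exact this.congr fun k => by rw [add_div]

theorem convDisc_logCoef {a b : ℂ} (ha : ∀ j : ℕ, a ≠ -(j : ℂ)) (hb : ∀ j : ℕ, b ≠ -(j : ℂ))
    (M : ℕ) : ConvDisc (logCoef a b M) := by
  refine ConvDisc.of_ratio (logCoef_ne_zero ha hb M) ?_
  have h := ((tendsto_norm_add_div_add a 1).mul (tendsto_norm_add_div_add b (M + 1))).norm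
  rw [mul_one, norm_one] at h
  refine h.congr fun k => ?_
  have h1 := natCast_add_one_ne_zero k
  have h2 := natCast_add_natCast_add_one_ne_zero k M
  have h3 := logCoef_ne_zero ha hb M k
  rw [← norm_div]
  congr 1
  rw [eq_div_iff h3]
  apply mul_left_cancel₀ h1
  rw [logCoef_succ, ← add_assoc]
  field_simp

theorem exists_norm_digamma_le {a : ℂ} (ha : ∀ j : ℕ, a ≠ -(j : ℂ)) :
    ∃ C : ℝ, 0 ≤ C ∧ ∀ k : ℕ, ‖Complex.digamma (a + k)‖ ≤ C * (k + 1) := by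
  have h2 : Tendsto (fun k : ℕ => ‖1 / (a + k)‖) atTop (𝓝 0) := by
    have h := (tendsto_inv_poch_add_natCast a 1).norm
    simpa [poch_succ, poch_zero, div_eq_mul_inv] using h
  obtain ⟨D, hD⟩ := h2.bddAbove_range
  have hD' : ∀ k : ℕ, ‖1 / (a + k)‖ ≤ D := fun k => hD ⟨k, rfl⟩
  have hD0 : 0 ≤ D := (norm_nonneg _).trans (hD' 0)
  refine ⟨‖Complex.digamma a‖ + D, by positivity, fun k => ?_⟩
  have : ‖Complex.digamma (a + k)‖ ≤ ‖Complex.digamma a‖ + D * k := by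
    induction k with
    | zero => simp
    | succ k ih =>
      rw [digamma_add_natCast_succ ha]
      refine (norm_add_le _ _).trans ?_
      push_cast
      linarith [hD' k]
  have h0 := norm_nonneg (Complex.digamma a)
  have hk : (0 : ℝ) ≤ k := k.cast_nonneg
  nlinarith

/-- A crude linear bound on ψ along a + k suffices, since a factor k + 1 does not affect convergence
in the disc. -/
theorem convDisc_psiCoef {a b : ℂ} (ha : ∀ j : ℕ, a ≠ -(j : ℂ)) (hb : ∀ j : ℕ, b ≠ -(j : ℂ))
    (M : ℕ) : ConvDisc (psiCoef a b M) := by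
  have hA := convDisc_logCoef ha hb M
  obtain ⟨C₁, h1, hC₁⟩ := exists_norm_digamma_le ha
  obtain ⟨C₂, h2, hC₂⟩ := exists_norm_digamma_le hb
  obtain ⟨C₃, h3, hC₃⟩ := exists_norm_digamma_le (a := 1)
    (by simpa using ne_neg_natCast_of_re_pos (a := 1))
  obtain ⟨C₄, h4, hC₄⟩ := exists_norm_digamma_le (a := 1 + M) (by
    refine ne_neg_natCast_of_re_pos ?_
    simp only [Complex.add_re, Complex.one_re, Complex.natCast_re]
    positivity)
  refine (hA.natCast_mul.add hA).of_norm_le (C₁ + C₂ + C₃ + C₄) fun k => ?_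
  have e : (k : ℂ) * logCoef a b M k + logCoef a b M k = logCoef a b M k * ((k : ℂ) + 1) := by
    ring
  have e2 : ‖(k : ℂ) + 1‖ = k + 1 := by
    rw [show (k : ℂ) + 1 = ((k + 1 : ℝ) : ℂ) by push_cast; rfl, Complex.norm_real,
      Real.norm_of_nonneg (by positivity)]
  rw [psiCoef, e, norm_mul, norm_mul, e2]
  have e3 : ‖digammaSum a b M k‖ ≤ (C₁ + C₂ + C₃ + C₄) * (k + 1) := by
    rw [digammaSum, show (k : ℂ) + 1 = 1 + k by ring, show (k : ℂ) + M + 1 = 1 + M + k by ring]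
    have n1 := norm_sub_le (Complex.digamma (a + k) + Complex.digamma (b + k)
      - Complex.digamma (1 + k)) (Complex.digamma (1 + M + k))
    have n2 := norm_sub_le (Complex.digamma (a + k) + Complex.digamma (b + k))
      (Complex.digamma (1 + k))
    have n3 := norm_add_le (Complex.digamma (a + k)) (Complex.digamma (b + k))
    linarith [hC₁ k, hC₂ k, hC₃ k, hC₄ k]
  calc _ ≤ ‖logCoef a b M k‖ * ((C₁ + C₂ + C₃ + C₄) * (k + 1)) := by gcongr
    _ = _ := by ring

/-! ### The zero-balanced connection formula -/

theorem one_sub_mem_slitPlane {z : ℂ} (hz : ‖z‖ < 1) : 1 - z ∈ Complex.slitPlane := by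
  left
  have := (Complex.re_le_norm z).trans_lt hz
  simp only [Complex.sub_re, Complex.one_re]
  linarith

theorem logSer_one_sub_hasDerivAt {A B : ℕ → ℂ} (hA : ConvDisc A) (hB : ConvDisc B) {z : ℂ}
    (hw : ‖1 - z‖ < 1) (hs : 1 - z ∈ Complex.slitPlane) :
    HasDerivAt (fun z => logSer A B (1 - z))
      (-(logSer (fun k => (k : ℂ) * A k) (fun k => (k : ℂ) * B k + A k) (1 - z) / (1 - z))) z := by
  exact (logSer_hasDerivAt hA hB hw hs).comp_const_sub 1 z

/-- The logarithmic solution solves the zero-balanced hypergeometric equation. -/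
theorem logSer_zero_balanced_ode {a b : ℂ} (ha : ∀ j : ℕ, a ≠ -(j : ℂ))
    (hb : ∀ j : ℕ, b ≠ -(j : ℂ)) {w : ℂ} (hw : ‖w‖ < 1) :
    (1 - w) * logSer (fun k => (k : ℂ) * (k * logCoef a b 0 k))
        (fun k => (k : ℂ) * (k * psiCoef a b 0 k + logCoef a b 0 k) + k * logCoef a b 0 k) w
      = w * ((a + b) * logSer (fun k => (k : ℂ) * logCoef a b 0 k)
          (fun k => (k : ℂ) * psiCoef a b 0 k + logCoef a b 0 k) w
        + a * b * logSer (logCoef a b 0) (psiCoef a b 0) w) := by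
  have hA := convDisc_logCoef ha hb 0
  have hB := convDisc_psiCoef ha hb 0
  have hA1 := hA.natCast_mul
  have hB1 := hB.natCast_mul.add hA
  have hA2 := hA1.natCast_mul
  have hB2 := hB1.natCast_mul.add hA1
  have h := logSer_eq hA2 hB2 hw
  simp only [Nat.cast_zero, zero_mul, mul_zero, add_zero, zero_add] at h
  -- With θ = w d/dw the equation is θ²L = w(θ+a)(θ+b)L, which on the A-coefficients reads (k+1)²
  -- A_{k+1} = (k+a)(k+b) A_k.
  have eA : ∀ k : ℕ, ((k + 1 : ℕ) : ℂ) * (((k + 1 : ℕ) : ℂ) * logCoef a b 0 (k + 1))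
      = (k : ℂ) * (k * logCoef a b 0 k)
        + ((a + b) * (k * logCoef a b 0 k) + a * b * logCoef a b 0 k) := by
    intro k
    have h1 := natCast_add_one_ne_zero k
    have := logCoef_succ a b 0 k
    push_cast at this ⊢
    rw [this]
    rw [add_zero]
    field_simp
    ring
  -- This is the formal derivative in k of the preceding recurrence; the digamma sum plays the role
  -- of the logarithmic derivative of the A-coefficients.
  have eB : ∀ k : ℕ, ((k + 1 : ℕ) : ℂ) * (((k + 1 : ℕ) : ℂ) * psiCoef a b 0 (k + 1)
        + logCoef a b 0 (k + 1)) + ((k + 1 : ℕ) : ℂ) * logCoef a b 0 (k + 1)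
      = ((k : ℂ) * (k * psiCoef a b 0 k + logCoef a b 0 k) + k * logCoef a b 0 k)
        + ((a + b) * (k * psiCoef a b 0 k + logCoef a b 0 k) + a * b * psiCoef a b 0 k) := by
    intro k
    have h1 := natCast_add_one_ne_zero k
    have h2 := add_natCast_ne_zero ha k
    have h3 := add_natCast_ne_zero hb k
    have h4 := logCoef_succ a b 0 k
    have h5 : logCoef a b 0 (k + 1) = (a + k) * (b + k) / ((k + 1) * (k + 1))
        * logCoef a b 0 k := by
      apply mul_left_cancel₀ h1
      rw [h4]
      push_cast
      rw [add_zero]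
      field_simp
    rw [psiCoef, psiCoef, digammaSum_succ ha hb, h5]
    push_cast
    rw [add_zero]
    field_simp
    ring
  rw [funext eA, funext eB, logSer_add hA2 hB2 ((hA1.const_mul _).add (hA.const_mul _))
    ((hB1.const_mul _).add (hB.const_mul _)) hw, logSer_add (hA1.const_mul _) (hB1.const_mul _)
    (hA.const_mul _) (hB.const_mul _) hw, logSer_const_mul, logSer_const_mul] at h
  linear_combination h

theorem tendsto_pser_of_summable {c : ℕ → ℂ} (hc : Summable fun k => ‖c k‖) :
    Tendsto (fun x : ℝ => pser c x) (𝓝[<] 1) (𝓝 (∑' k, c k)) := by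
  refine tendsto_tsum_of_dominated_convergence hc (fun k => ?_) ?_
  · have : Continuous fun x : ℝ => c k * (x : ℂ) ^ k := by fun_prop
    have := (this.tendsto 1).mono_left (nhdsWithin_le_nhds (s := Set.Iio 1))
    simpa using this
  · filter_upwards [Ioo_mem_nhdsLT (zero_lt_one (α := ℝ))] with x hx k
    rw [norm_mul, norm_pow, Complex.norm_real, Real.norm_of_nonneg hx.1.le]
    exact mul_le_of_le_one_right (norm_nonneg _) (pow_le_one₀ hx.1.le hx.2.le)

theorem ConvDisc.tendsto_pser_one_sub {c : ℕ → ℂ} (hc : ConvDisc c) :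
    Tendsto (fun x : ℝ => pser c (1 - x)) (𝓝[<] 1) (𝓝 (c 0)) := by
  have := (hc.continuousAt (z := 0) (by simp)).tendsto.comp tendsto_ofReal_one_sub
  rwa [pser_zero] at this

theorem convDisc_one_div : ConvDisc fun k : ℕ => 1 / ((k : ℂ) + 1) := by
  refine ConvDisc.of_bounded 1 fun k => ?_
  rw [norm_div, norm_one, show (k : ℂ) + 1 = ((k + 1 : ℝ) : ℂ) by push_cast; rfl,
    Complex.norm_real, Real.norm_of_nonneg (by positivity)]
  exact div_le_one_of_le₀ (by have : (0 : ℝ) ≤ k := k.cast_nonneg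
                              linarith) (by positivity)

theorem mul_pser_one_div {z : ℂ} (hz : ‖z‖ < 1) :
    z * pser (fun k : ℕ => 1 / ((k : ℂ) + 1)) z = -Complex.log (1 - z) := by
  have h := Complex.hasSum_taylorSeries_neg_log hz
  rw [← h.tsum_eq, h.summable.tsum_eq_zero_add, pser, ← tsum_mul_left]
  simp only [pow_zero, Nat.cast_zero, div_zero, zero_add]
  refine tsum_congr fun k => ?_
  push_cast
  ring

theorem exists_norm_hypCoef_zero_balanced_sub_le {a b : ℂ} (ha : ∀ j : ℕ, a ≠ -(j : ℂ))
    (hb : ∀ j : ℕ, b ≠ -(j : ℂ)) :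
    ∃ K : ℝ, ∀ k : ℕ, ‖hypCoef a b (a + b) k - 1 / ((k : ℂ) + 1)‖ ≤ K / ((k : ℝ) + 1) ^ 2 := by
  obtain ⟨K, hK⟩ := exists_norm_hypCoef_sub_le ha hb
  refine ⟨K, fun k => ?_⟩
  have := hK.self_of_nhdsWithin (by simp) k
  rwa [Complex.ofReal_zero, add_zero, add_zero, hypCoef_one_one_two] at this

theorem summable_hypCoef_zero_balanced_sub {a b : ℂ} (ha : ∀ j : ℕ, a ≠ -(j : ℂ))
    (hb : ∀ j : ℕ, b ≠ -(j : ℂ)) :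
    Summable fun k : ℕ => ‖hypCoef a b (a + b) k - 1 / ((k : ℂ) + 1)‖ := by
  obtain ⟨K, hK⟩ := exists_norm_hypCoef_zero_balanced_sub_le ha hb
  refine Summable.of_nonneg_of_le (fun _ => norm_nonneg _) hK ?_
  have := (summable_nat_add_iff 1).2 (Real.summable_one_div_nat_pow.2 (by norm_num : 1 < 2))
  simpa [div_eq_mul_inv] using this.mul_left K

theorem convDisc_hypCoef_zero_balanced {a b : ℂ} (ha : ∀ j : ℕ, a ≠ -(j : ℂ))
    (hb : ∀ j : ℕ, b ≠ -(j : ℂ)) : ConvDisc (hypCoef a b (a + b)) := by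
  obtain ⟨C, hC⟩ := (summable_hypCoef_zero_balanced_sub ha hb).tendsto_atTop_zero.bddAbove_range
  have h := (ConvDisc.of_bounded C fun k => hC ⟨k, rfl⟩).add convDisc_one_div
  simpa using h

/-- The left side is the k-th coefficient of (1 - z)F'. The right side is summable at z = 1, so this
second unknown of the system has a finite limit there. -/
theorem hypCoef_zero_balanced_increment {a b : ℂ} (ha : ∀ j : ℕ, a ≠ -(j : ℂ))
    (hb : ∀ j : ℕ, b ≠ -(j : ℂ)) (k : ℕ) :
    ((k : ℂ) + 1) * hypCoef a b (a + b) (k + 1) - k * hypCoef a b (a + b) k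
      = a * b * hypCoef a b (a + b + 1) k := by
  rw [succ_mul_hypCoef_succ ha hb, hypCoef_eq_mul_succ_right a b (a + b)]
  ring

theorem summable_hypCoef_excess_one (a b : ℂ) : Summable (hypCoef a b (a + b + 1)) :=
  hypCoef_summable (by rw [show a + b + 1 - a - b = 1 by ring]; simp)

theorem convDisc_hypCoef_excess_one (a b : ℂ) : ConvDisc (hypCoef a b (a + b + 1)) := by
  obtain ⟨C, hC⟩ := (summable_hypCoef_excess_one a b).norm.tendsto_atTop_zero.bddAbove_range
  exact ConvDisc.of_bounded C fun k => hC ⟨k, rfl⟩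

theorem tsum_hypCoef_excess_one {a b : ℂ} (ha : ∀ j : ℕ, a ≠ -(j : ℂ))
    (hb : ∀ j : ℕ, b ≠ -(j : ℂ)) : ∑' k, a * b * hypCoef a b (a + b + 1) k = 1 := by
  have e1 : a + b + 1 - a = b + (1 : ℕ) := by push_cast; ring
  have e2 : a + b + 1 - b = a + (1 : ℕ) := by push_cast; ring
  have e3 : a + b + 1 - a - b = 1 := by ring
  rw [tsum_mul_left, tsum_hypCoef ha hb (by rw [e1]; exact add_natCast_ne hb 1)
    (by rw [e2]; exact add_natCast_ne ha 1) (by rw [e3]; simp), e1, e2, add_sub_cancel_left,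
    Nat.cast_one, Complex.Gamma_one]
  have ha0 : a ≠ 0 := by simpa using ha 0
  have hb0 : b ≠ 0 := by simpa using hb 0
  have g1 := Complex.Gamma_ne_zero ha
  have g2 := Complex.Gamma_ne_zero hb
  rw [Complex.Gamma_add_one _ ha0, Complex.Gamma_add_one _ hb0]
  field_simp

theorem hasDerivAt_pser_zero_balanced {a b : ℂ} (ha : ∀ j : ℕ, a ≠ -(j : ℂ))
    (hb : ∀ j : ℕ, b ≠ -(j : ℂ)) {z : ℂ} (hz : ‖z‖ < 1) (hz1 : 1 - z ≠ 0) :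
    HasDerivAt (pser (hypCoef a b (a + b)))
      (pser (fun k => a * b * hypCoef a b (a + b + 1) k) z / (1 - z)) z := by
  have hT := convDisc_hypCoef_zero_balanced ha hb
  refine (hT.hasDerivAt hz).congr_deriv ?_
  rw [eq_div_iff hz1, mul_sub, mul_one, mul_comm _ z, hT.mul_deriv_eq hz, sub_eq_iff_eq_add,
    ← ((convDisc_hypCoef_excess_one a b).const_mul _).pser_add hT.natCast_mul hz]
  congr 1
  funext k
  rw [← hypCoef_zero_balanced_increment ha hb]
  ring

theorem hasDerivAt_pser_excess_one {a b : ℂ} (ha : ∀ j : ℕ, a ≠ -(j : ℂ))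
    (hb : ∀ j : ℕ, b ≠ -(j : ℂ)) {z : ℂ} (hz : ‖z‖ < 1) (hz0 : z ≠ 0) :
    HasDerivAt (pser (fun k => a * b * hypCoef a b (a + b + 1) k))
      ((a * b * pser (hypCoef a b (a + b)) z
        - (a + b) * pser (fun k => a * b * hypCoef a b (a + b + 1) k) z) / z) z := by
  have hT := convDisc_hypCoef_zero_balanced ha hb
  have hH := (convDisc_hypCoef_excess_one a b).const_mul (a * b)
  refine (hH.hasDerivAt hz).congr_deriv ?_
  rw [eq_div_iff hz0, mul_comm _ z, hH.mul_deriv_eq hz, eq_sub_iff_add_eq,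
    ← pser_const_mul, ← pser_const_mul, ← hH.natCast_mul.pser_add (hH.const_mul _) hz]
  congr 1
  funext k
  rw [hypCoef_eq_mul_succ_right a b (a + b)]
  ring

theorem tendsto_zero_balanced_difference {a b : ℂ} (ha : ∀ j : ℕ, a ≠ -(j : ℂ))
    (hb : ∀ j : ℕ, b ≠ -(j : ℂ)) :
    Tendsto (fun x : ℝ => pser (hypCoef a b (a + b)) x
      + logSer (logCoef a b 0) (psiCoef a b 0) (1 - x)) (𝓝[<] 1) (𝓝 0) := by
  have hA := convDisc_logCoef ha hb 0
  have hB := convDisc_psiCoef ha hb 0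
  have hT := convDisc_hypCoef_zero_balanced ha hb
  have hD : ConvDisc fun k : ℕ => hypCoef a b (a + b) k - 1 / ((k : ℂ) + 1) := by
    have := hT.add (convDisc_one_div.const_mul (-1))
    refine this.of_norm_le 1 fun k => ?_
    rw [one_mul, neg_one_mul, sub_eq_add_neg]
  have l1 := tendsto_pser_of_summable (summable_hypCoef_zero_balanced_sub ha hb)
  rw [tsum_hypCoef_zero_balanced ha hb] at l1
  have lx : Tendsto (fun x : ℝ => 1 / (x : ℂ)) (𝓝[<] 1) (𝓝 1) := by
    have : ContinuousAt (fun x : ℝ => 1 / (x : ℂ)) 1 := by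
      refine ContinuousAt.div (by fun_prop) (by fun_prop) (by simp)
    simpa using this.tendsto.mono_left nhdsWithin_le_nhds
  -- With w = 1 - x and A(w) = 1 + w A₁(w), the logarithmic terms combine to log w (A(w) - 1/x) = w
  -- log w (A₁(w) - 1/x).
  have l2 := tendsto_one_sub_mul_log.mul (hA.succ.tendsto_pser_one_sub.sub lx)
  have l3 := hB.tendsto_pser_one_sub
  have l := (l1.add l2).add l3
  have e0 : psiCoef a b 0 0 = Complex.digamma a + Complex.digamma b - 2 * Complex.digamma 1 := by
    simp [psiCoef, logCoef, digammaSum, poch_zero]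
    ring
  rw [e0, zero_mul, show 2 * Complex.digamma 1 - Complex.digamma a - Complex.digamma b + 0
    + (Complex.digamma a + Complex.digamma b - 2 * Complex.digamma 1) = 0 by ring] at l
  refine l.congr' ?_
  filter_upwards [Ioo_mem_nhdsLT (zero_lt_one (α := ℝ))] with x hx
  have hxn : ‖(x : ℂ)‖ < 1 := by
    rw [Complex.norm_real, Real.norm_of_nonneg hx.1.le]
    exact hx.2
  have hx0 : (x : ℂ) ≠ 0 := by exact_mod_cast hx.1.ne'
  have hw := norm_ofReal_one_sub_lt hx.1 hx.2
  have eT : pser (hypCoef a b (a + b)) x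
      = pser (fun k : ℕ => hypCoef a b (a + b) k - 1 / ((k : ℂ) + 1)) x
        + pser (fun k : ℕ => 1 / ((k : ℂ) + 1)) x := by
    rw [← hD.pser_add convDisc_one_div hxn]
    simp
  have eL : pser (fun k : ℕ => 1 / ((k : ℂ) + 1)) (x : ℂ) = -Complex.log (1 - x) / x := by
    rw [eq_div_iff hx0, mul_comm]
    exact mul_pser_one_div hxn
  have eA0 : logCoef a b 0 0 = 1 := by simp [logCoef, poch_zero]
  rw [eT, eL, logSer, hA.pser_eq hw, eA0]
  field_simp
  ring

/-- Both parts tend to 1: the series by Gauss's theorem with excess 1, the logarithmic part because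
kA_k vanishes at k = 0, leaving w log w → 0 and the constant A_0 = 1. -/
theorem tendsto_zero_balanced_derivative_difference {a b : ℂ} (ha : ∀ j : ℕ, a ≠ -(j : ℂ))
    (hb : ∀ j : ℕ, b ≠ -(j : ℂ)) :
    Tendsto (fun x : ℝ => pser (fun k => a * b * hypCoef a b (a + b + 1) k) x
      - logSer (fun k => (k : ℂ) * logCoef a b 0 k)
          (fun k => (k : ℂ) * psiCoef a b 0 k + logCoef a b 0 k) (1 - x)) (𝓝[<] 1) (𝓝 0) := by
  have hA := convDisc_logCoef ha hb 0
  have hB := convDisc_psiCoef ha hb 0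
  have l1 := tendsto_pser_of_summable ((summable_hypCoef_excess_one a b).mul_left (a * b)).norm
  rw [tsum_hypCoef_excess_one ha hb] at l1
  have l2 := tendsto_one_sub_mul_log.mul hA.natCast_mul.succ.tendsto_pser_one_sub
  have l3 := (hB.natCast_mul.add hA).tendsto_pser_one_sub
  have l := l1.sub (l2.add l3)
  have eA0 : logCoef a b 0 0 = 1 := by simp [logCoef, poch_zero]
  rw [eA0, Nat.cast_zero, zero_mul, zero_mul, zero_add, zero_add, sub_self] at l
  refine l.congr' ?_
  filter_upwards [Ioo_mem_nhdsLT (zero_lt_one (α := ℝ))] with x hx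
  have hw := norm_ofReal_one_sub_lt hx.1 hx.2
  rw [logSer, hA.natCast_mul.pser_eq hw, Nat.cast_zero, zero_mul]
  ring

/-- Connection formula in the zero-balanced case, near `1` on the real line. -/
theorem eventually_zero_balanced {a b : ℂ} (ha : ∀ j : ℕ, a ≠ -(j : ℂ))
    (hb : ∀ j : ℕ, b ≠ -(j : ℂ)) :
    ∀ᶠ x : ℝ in 𝓝[<] 1, pser (hypCoef a b (a + b)) x
      + logSer (logCoef a b 0) (psiCoef a b 0) (1 - x) = 0 := by
  have hA := convDisc_logCoef ha hb 0
  have hB := convDisc_psiCoef ha hb 0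
  have hA1 := hA.natCast_mul
  have hB1 := hB.natCast_mul.add hA
  have key : ∀ x : ℝ, 1 / 2 < x → x < 1 → ‖(x : ℂ)‖ < 1 ∧ (x : ℂ) ≠ 0 ∧ ‖(1 : ℂ) - x‖ < 1
      ∧ (1 : ℂ) - x ≠ 0 := by
    intro x h0 h1
    have hx0 : 0 < x := by linarith
    refine ⟨?_, by exact_mod_cast hx0.ne', norm_ofReal_one_sub_lt hx0 h1, ?_⟩
    · rw [Complex.norm_real, Real.norm_of_nonneg hx0.le]
      exact h1
    · exact_mod_cast (sub_pos.2 h1).ne'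
  refine eventually_eq_zero_of_system (p := a * b) (s := a + b)
    (P := fun x : ℝ => pser (fun k => a * b * hypCoef a b (a + b + 1) k) x
      - logSer (fun k => (k : ℂ) * logCoef a b 0 k)
          (fun k => (k : ℂ) * psiCoef a b 0 k + logCoef a b 0 k) (1 - x))
    (fun x h0 h1 => ?_) (fun x h0 h1 => ?_) (tendsto_zero_balanced_difference ha hb)
    (tendsto_zero_balanced_derivative_difference ha hb)
  · obtain ⟨k1, k2, k3, k4⟩ := key x h0 h1
    have hd := (hasDerivAt_pser_zero_balanced ha hb k1 k4).add
      (logSer_one_sub_hasDerivAt hA hB k3 (one_sub_mem_slitPlane k1))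
    refine hd.comp_ofReal.congr_deriv ?_
    ring
  · obtain ⟨k1, k2, k3, k4⟩ := key x h0 h1
    have hd := (hasDerivAt_pser_excess_one ha hb k1 k2).sub
      (logSer_one_sub_hasDerivAt hA1 hB1 k3 (one_sub_mem_slitPlane k1))
    refine hd.comp_ofReal.congr_deriv ?_
    have hode := logSer_zero_balanced_ode ha hb k3
    rw [sub_sub_cancel] at hode
    generalize logSer _ _ _ = L₂ at hode ⊢
    field_simp
    linear_combination hode

/-- Connection formula in the zero-balanced case. -/
theorem pser_zero_balanced {a b : ℂ} (ha : ∀ j : ℕ, a ≠ -(j : ℂ))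
    (hb : ∀ j : ℕ, b ≠ -(j : ℂ)) {z : ℂ} (hz : ‖z‖ < 1) (hw : ‖1 - z‖ < 1) :
    pser (hypCoef a b (a + b)) z = -logSer (logCoef a b 0) (psiCoef a b 0) (1 - z) := by
  have hA := convDisc_logCoef ha hb 0
  have hB := convDisc_psiCoef ha hb 0
  have hT := convDisc_hypCoef_zero_balanced ha hb
  set U : Set ℂ := Metric.ball 0 1 ∩ Metric.ball 1 1 with hU
  have hUo : IsOpen U := Metric.isOpen_ball.inter Metric.isOpen_ball
  have hUc : IsPreconnected U := ((convex_ball _ _).inter (convex_ball _ _)).isPreconnected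
  have hmem : ∀ y : ℂ, y ∈ U ↔ ‖y‖ < 1 ∧ ‖1 - y‖ < 1 := by
    intro y
    rw [hU, Set.mem_inter_iff, Metric.mem_ball, Metric.mem_ball, dist_zero_right, dist_comm,
      dist_eq_norm]
  have hf : AnalyticOnNhd ℂ (fun y => pser (hypCoef a b (a + b)) y
      + logSer (logCoef a b 0) (psiCoef a b 0) (1 - y)) U := by
    refine DifferentiableOn.analyticOnNhd (fun y hy => ?_) hUo
    obtain ⟨h1, h2⟩ := (hmem y).1 hy
    exact ((hT.hasDerivAt h1).add (logSer_one_sub_hasDerivAt hA hB h2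
      (one_sub_mem_slitPlane h1))).differentiableAt.differentiableWithinAt
  obtain ⟨y, hy1, hy⟩ := (mem_nhdsLT_iff_exists_Ioo_subset (a := (1 : ℝ))).1
    (eventually_zero_balanced ha hb)
  obtain ⟨x₀, hx₀, hx₀1⟩ := exists_between (max_lt hy1 (zero_lt_one (α := ℝ)))
  have hx₀y : y < x₀ := (le_max_left _ _).trans_lt hx₀
  have hx₀0 : 0 < x₀ := (le_max_right _ _).trans_lt hx₀
  have hx₀U : (x₀ : ℂ) ∈ U := by
    refine (hmem _).2 ⟨?_, norm_ofReal_one_sub_lt hx₀0 hx₀1⟩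
    rw [Complex.norm_real, Real.norm_of_nonneg hx₀0.le]
    exact hx₀1
  -- A real interval accumulates at x₀ inside the lens, so the identity theorem applies although
  -- equality is known only for real arguments.
  have hmap : Tendsto (fun x : ℝ => (x : ℂ)) (𝓝[≠] x₀) (𝓝[≠] (x₀ : ℂ)) := by
    refine tendsto_nhdsWithin_iff.2
      ⟨(Complex.continuous_ofReal.tendsto x₀).mono_left nhdsWithin_le_nhds, ?_⟩
    filter_upwards [self_mem_nhdsWithin] with x hx
    simpa using hx
  have hfreq : ∃ᶠ y in 𝓝[≠] (x₀ : ℂ), pser (hypCoef a b (a + b)) y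
      + logSer (logCoef a b 0) (psiCoef a b 0) (1 - y) = 0 := by
    refine hmap.frequently (Eventually.frequently ?_)
    filter_upwards [nhdsWithin_le_nhds (Ioo_mem_nhds hx₀y hx₀1)] with x hx
    exact hy hx
  have := hf.eqOn_zero_of_preconnected_of_frequently_eq_zero hUc hx₀U hfreq
    ((hmem z).2 ⟨hz, hw⟩)
  exact eq_neg_of_add_eq_zero_left this

/-! ### Induction on M: lowering the parameter c -/

/-- The coefficients of the singular part. -/
noncomputable def polarCoef (a b : ℂ) (M k : ℕ) : ℂ :=
  (-1) ^ k / (k ! : ℂ) * poch (a - M) k * poch (b - M) k * Complex.Gamma (M - k)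

/-- The factor of the logarithmic part. -/
noncomputable def logFactor (a b : ℂ) (M : ℕ) : ℂ := (-1) ^ (M + 1) * poch (a - M) M * poch (b - M) M

theorem logFactor_succ (a b : ℂ) (M : ℕ) :
    logFactor a b (M + 1) = -((a - M - 1) * (b - M - 1)) * logFactor a b M := by
  rw [logFactor, logFactor, poch_succ_left, poch_succ_left]
  push_cast
  rw [show a - (M + 1) + 1 = a - M by ring, show b - (M + 1) + 1 = b - M by ring]
  ring

theorem logCoef_succ_left (a b : ℂ) (M k : ℕ) :
    logCoef a b (M + 1) k = logCoef a b M k / (k + M + 1) := by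
  have h2 := natCast_add_natCast_add_one_ne_zero k M
  have h3 := factorial_ne_zero_complex k
  have h4 := factorial_ne_zero_complex (k + M)
  rw [logCoef, logCoef, ← add_assoc, factorial_succ_complex]
  push_cast
  field_simp

/-- Each power w^k receives contributions from the indices k and k - 1, which add up to the next
polar coefficient. At the cut-off w^j only the second is present, and this gives the explicit
remainder. The bound j ≤ M keeps M - k nonzero in the recurrence for Γ(M - k). -/
theorem polarCoef_partial_sum (a b w : ℂ) (M j : ℕ) (hj : j ≤ M) :
    ∑ k ∈ Finset.range j, polarCoef a b M k
        * ((M - k) * w ^ k + (k + a + b - 2 * M - 1) * w ^ (k + 1))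
      = ∑ k ∈ Finset.range j, polarCoef a b (M + 1) k * w ^ k
        + (-1) ^ j / (j ! : ℂ) * Complex.Gamma (M + 1 - j)
          * (poch (a - (M + 1)) j * poch (b - (M + 1)) j - poch (a - M) j * poch (b - M) j)
          * w ^ j := by
  induction j with
  | zero => simp [poch_zero]
  | succ j ih =>
    have hne : (M : ℂ) - j ≠ 0 := by
      rw [sub_ne_zero]
      exact_mod_cast (by omega : M ≠ j)
    have hG : Complex.Gamma (M + 1 - j) = (M - j) * Complex.Gamma (M - j) := by
      rw [← Complex.Gamma_add_one _ hne]
      ring_nf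
    have h1 := natCast_add_one_ne_zero j
    have h2 := factorial_ne_zero_complex j
    rw [Finset.sum_range_succ, Finset.sum_range_succ, ih (by omega), polarCoef, polarCoef,
      poch_succ_left (a - (M + 1)) j, poch_succ_left (b - (M + 1)) j, poch_succ (a - M) j,
      poch_succ (b - M) j, factorial_succ_complex]
    push_cast
    rw [show (M : ℂ) + 1 - (j + 1) = M - j by ring, hG,
      show a - (M + 1) + 1 = a - M by ring, show b - (M + 1) + 1 = b - M by ring]
    field_simp
    ring

/-- At the cut-off M the remainder splits into the new last polar coefficient and a term
proportional to the first logarithmic coefficient. -/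
theorem polarCoef_sum (a b w : ℂ) (M : ℕ) :
    ∑ k ∈ Finset.range M, polarCoef a b M k
        * ((M - k) * w ^ k + (k + a + b - 2 * M - 1) * w ^ (k + 1))
      = ∑ k ∈ Finset.range (M + 1), polarCoef a b (M + 1) k * w ^ k
        + logFactor a b M * logCoef a b M 0 * w ^ M := by
  rw [polarCoef_partial_sum a b w M M le_rfl, Finset.sum_range_succ, polarCoef, logFactor, logCoef]
  have h2 := factorial_ne_zero_complex M
  push_cast
  rw [add_sub_cancel_left, Complex.Gamma_one, poch_zero, poch_zero, Nat.factorial_zero, zero_add]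
  push_cast
  field_simp
  ring

/-- The singular part of the connection formula. -/
noncomputable def polarPart (a b : ℂ) (M : ℕ) (w : ℂ) : ℂ :=
  ∑ k ∈ Finset.range M, polarCoef a b M k * w ^ ((k : ℤ) - M)

theorem polarPart_hasDerivAt (a b : ℂ) (M : ℕ) {w : ℂ} (hw : w ≠ 0) :
    HasDerivAt (polarPart a b M)
      (∑ k ∈ Finset.range M, polarCoef a b M k * ((k - M) * w ^ ((k : ℤ) - M - 1))) w := by
  refine HasDerivAt.fun_sum fun k _ => ?_
  have := (hasDerivAt_zpow ((k : ℤ) - M) w (Or.inl hw)).const_mul (polarCoef a b M k)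
  push_cast at this
  exact this

/-- In w = 1 - z the lowering operator is -(1-w) d/dw + (a+b-M-1). The extra 1/w term cancels
against the one created by differentiating the logarithm in `logSer_succ`. -/
theorem polarPart_succ (a b : ℂ) (M : ℕ) {w : ℂ} (hw : w ≠ 0) :
    -(1 - w) * ∑ k ∈ Finset.range M, polarCoef a b M k * ((k - M) * w ^ ((k : ℤ) - M - 1))
      + (a + b - M - 1) * polarPart a b M w
      = polarPart a b (M + 1) w + logFactor a b M * logCoef a b M 0 / w := by
  have h := polarCoef_sum a b w M
  have hM : w ^ (M + 1) ≠ 0 := pow_ne_zero _ hw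
  apply mul_right_cancel₀ hM
  rw [add_mul, add_mul, mul_assoc, mul_assoc, polarPart, polarPart, Finset.sum_mul,
    Finset.sum_mul, Finset.sum_mul]
  have e1 : ∀ k : ℕ, polarCoef a b (M + 1) k * w ^ ((k : ℤ) - (M + 1 : ℕ)) * w ^ (M + 1)
      = polarCoef a b (M + 1) k * w ^ k := by
    intro k
    rw [mul_assoc, ← zpow_natCast w (M + 1), ← zpow_add₀ hw, sub_add_cancel, zpow_natCast]
  have e2 : ∀ k : ℕ, polarCoef a b M k * w ^ ((k : ℤ) - M) * w ^ (M + 1)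
      = polarCoef a b M k * w ^ (k + 1) := by
    intro k
    rw [mul_assoc, ← zpow_natCast w (M + 1), ← zpow_add₀ hw, ← zpow_natCast]
    push_cast
    ring_nf
  have e3 : ∀ k : ℕ, polarCoef a b M k * ((k - M) * w ^ ((k : ℤ) - M - 1)) * w ^ (M + 1)
      = polarCoef a b M k * ((k - M) * w ^ k) := by
    intro k
    rw [mul_assoc, mul_assoc, ← zpow_natCast w (M + 1), ← zpow_add₀ hw, ← zpow_natCast]
    push_cast
    ring_nf
  simp only [e1, e2, e3]
  have e4 : logFactor a b M * logCoef a b M 0 / w * w ^ (M + 1)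
      = logFactor a b M * logCoef a b M 0 * w ^ M := by
    rw [pow_succ]
    field_simp
  rw [e4, ← h, Finset.mul_sum, Finset.mul_sum, ← Finset.sum_add_distrib]
  refine Finset.sum_congr rfl fun k _ => ?_
  ring

/-- The same lowering operator, multiplied by w. The constant -A_0 comes from w d/dw log w = 1. -/
theorem logSer_succ {a b : ℂ} (ha : ∀ j : ℕ, a ≠ -(j : ℂ)) (hb : ∀ j : ℕ, b ≠ -(j : ℂ)) (M : ℕ)
    {w : ℂ} (hw : ‖w‖ < 1) :
    -(1 - w) * logSer (fun k => (k : ℂ) * logCoef a b M k)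
        (fun k => (k : ℂ) * psiCoef a b M k + logCoef a b M k) w
      + (a + b - M - 1) * w * logSer (logCoef a b M) (psiCoef a b M) w
      = -logCoef a b M 0 + w * (-((a - M - 1) * (b - M - 1))
          * logSer (logCoef a b (M + 1)) (psiCoef a b (M + 1)) w) := by
  have hA := convDisc_logCoef ha hb M
  have hB := convDisc_psiCoef ha hb M
  have hA1 := hA.natCast_mul
  have hB1 := hB.natCast_mul.add hA
  have hA' := convDisc_logCoef ha hb (M + 1)
  have hB' := convDisc_psiCoef ha hb (M + 1)
  have h := logSer_eq hA1 hB1 hw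
  simp only [Nat.cast_zero, zero_mul, mul_zero, zero_add] at h
  -- This rests on (k+a)(k+b) = (k+M+1)(k+a+b-M-1) + (a-M-1)(b-M-1).
  have eA : ∀ k : ℕ, ((k + 1 : ℕ) : ℂ) * logCoef a b M (k + 1)
      = (k : ℂ) * logCoef a b M k + ((a + b - M - 1) * logCoef a b M k
        + (a - M - 1) * (b - M - 1) * logCoef a b (M + 1) k) := by
    intro k
    have h2 := natCast_add_natCast_add_one_ne_zero k M
    have := logCoef_succ a b M k
    push_cast
    rw [this, logCoef_succ_left]
    field_simp
    ring
  have eB : ∀ k : ℕ, ((k + 1 : ℕ) : ℂ) * psiCoef a b M (k + 1) + logCoef a b M (k + 1)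
      = ((k : ℂ) * psiCoef a b M k + logCoef a b M k) + ((a + b - M - 1) * psiCoef a b M k
        + (a - M - 1) * (b - M - 1) * psiCoef a b (M + 1) k) := by
    intro k
    have h1 := natCast_add_one_ne_zero k
    have h2 := natCast_add_natCast_add_one_ne_zero k M
    have h3 := add_natCast_ne_zero ha k
    have h4 := add_natCast_ne_zero hb k
    have h5 : logCoef a b M (k + 1) = (a + k) * (b + k) / ((k + 1) * (k + M + 1))
        * logCoef a b M k := by
      apply mul_left_cancel₀ h1
      rw [logCoef_succ]
      field_simp
    rw [psiCoef, psiCoef, psiCoef, digammaSum_succ ha hb, digammaSum_succ_left,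
      logCoef_succ_left, h5]
    push_cast
    field_simp
    ring
  rw [funext eA, funext eB, logSer_add hA1 hB1 ((hA.const_mul _).add (hA'.const_mul _))
    ((hB.const_mul _).add (hB'.const_mul _)) hw, logSer_add (hA.const_mul _) (hB.const_mul _)
    (hA'.const_mul _) (hB'.const_mul _) hw, logSer_const_mul, logSer_const_mul] at h
  linear_combination -h

theorem hypCoef_shift (a b : ℂ) (M k : ℕ) :
    hypCoef a b (a + b - (M + 1 : ℕ)) k
      = k * hypCoef a b (a + b - M) k + (a + b - M - 1) * hypCoef a b (a + b - M) k := by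
  rw [hypCoef_eq_mul_succ_right]
  push_cast
  rw [show a + b - (M + 1) + 1 = a + b - M by ring]
  ring

/-- Convergence is inherited from the zero-balanced case through the shift. The ratio criterion
`ConvDisc.of_ratio` would fail when a + b - M is a non-positive integer, where leading coefficients
vanish. -/
theorem convDisc_hypCoef {a b : ℂ} (ha : ∀ j : ℕ, a ≠ -(j : ℂ)) (hb : ∀ j : ℕ, b ≠ -(j : ℂ))
    (M : ℕ) : ConvDisc (hypCoef a b (a + b - M)) := by
  induction M with
  | zero => simpa using convDisc_hypCoef_zero_balanced ha hb
  | succ M ih =>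
    rw [funext (hypCoef_shift a b M)]
    exact ih.natCast_mul.add (ih.const_mul _)

/-- Connection formula between `0` and `1` for `₂F₁(a, b; a + b - M; z)`. -/
theorem pser_hypCoef_eq {a b : ℂ} (ha : ∀ j : ℕ, a ≠ -(j : ℂ)) (hb : ∀ j : ℕ, b ≠ -(j : ℂ))
    (M : ℕ) : ∀ {z : ℂ}, ‖z‖ < 1 → ‖1 - z‖ < 1 →
      pser (hypCoef a b (a + b - M)) z = polarPart a b M (1 - z)
        + logFactor a b M * logSer (logCoef a b M) (psiCoef a b M) (1 - z) := by
  induction M with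
  | zero =>
    intro z hz hw
    simp [polarPart, logFactor, poch_zero, pser_zero_balanced ha hb hz hw]
  | succ M ih =>
    intro z hz hw
    have hs := one_sub_mem_slitPlane hz
    have hw0 := Complex.slitPlane_ne_zero hs
    have hT := convDisc_hypCoef ha hb M
    have hA := convDisc_logCoef ha hb M
    have hB := convDisc_psiCoef ha hb M
    have d1 := hT.hasDerivAt hz
    have d2 := ((polarPart_hasDerivAt a b M hw0).comp_const_sub 1 z).add
      ((logSer_one_sub_hasDerivAt hA hB hw hs).const_mul (logFactor a b M))
    have hev : pser (hypCoef a b (a + b - M)) =ᶠ[𝓝 z] fun y => polarPart a b M (1 - y)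
        + logFactor a b M * logSer (logCoef a b M) (psiCoef a b M) (1 - y) := by
      have c1 : ∀ᶠ y in 𝓝 z, ‖y‖ < 1 :=
        (continuous_norm.tendsto z).eventually_lt_const hz
      have c2 : ∀ᶠ y in 𝓝 z, ‖1 - y‖ < 1 :=
        ((continuous_const.sub continuous_id).norm.tendsto z).eventually_lt_const hw
      filter_upwards [c1, c2] with y h1 h2 using ih h1 h2
    -- The induction hypothesis holds near z, so both sides may be differentiated; uniqueness of the
    -- derivative equates the results.
    have hd := d1.unique (d2.congr_of_eventuallyEq hev)
    have hz' : z = 1 - (1 - z) := by ring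
    have e1 : pser (hypCoef a b (a + b - (M + 1 : ℕ))) z
        = z * pser (fun k => ((k : ℂ) + 1) * hypCoef a b (a + b - M) (k + 1)) z
          + (a + b - M - 1) * pser (hypCoef a b (a + b - M)) z := by
      rw [hT.mul_deriv_eq hz, ← pser_const_mul, ← hT.natCast_mul.pser_add (hT.const_mul _) hz,
        funext (hypCoef_shift a b M)]
    rw [e1, hd, ih hz hw, logFactor_succ]
    have p1 := polarPart_succ a b M hw0
    have p2 := logSer_succ ha hb M hw
    rw [sub_sub_cancel] at p1 p2
    generalize logSer (fun k => (k : ℂ) * logCoef a b M k) _ _ = L₁ at p2 ⊢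
    field_simp at p1 ⊢
    linear_combination p1 + logFactor a b M * p2

/-! ### From the ₂F₁ series to its ₃F₂ tail -/

/-- Valid at the poles of Γ as well, so the prefactor 1/(Γ(β+σ-ν)Γ(σ)) needs no case distinction. -/
theorem inv_Gamma_eq_poch_mul (x : ℂ) (M : ℕ) :
    (Complex.Gamma x)⁻¹ = poch x M * (Complex.Gamma (x + M))⁻¹ := by
  induction M with
  | zero => simp [poch_zero]
  | succ M ih => rw [ih, inv_Gamma_add_natCast, poch_succ, mul_assoc]

theorem factorial_add_eq_poch (N j : ℕ) : ((N + j)! : ℂ) = (N ! : ℂ) * poch (N + 1) j := by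
  induction j with
  | zero => simp [poch_zero]
  | succ j ih =>
    rw [← add_assoc, factorial_succ_complex, ih, poch_succ]
    push_cast
    ring

theorem poch_one (j : ℕ) : poch 1 j = (j ! : ℂ) := by
  have := factorial_add_eq_poch 0 j
  simpa using this.symm

/-- The factor between the tail of the `₂F₁` series and the `₃F₂` series. -/
noncomputable def tailFactor (a b c : ℂ) (N : ℕ) : ℂ :=
  Complex.Gamma (a + N) * poch b N / (Complex.Gamma (c + N) * (N ! : ℂ))

theorem tailFactor_ne_zero {a b c : ℂ} {N : ℕ} (ha : ∀ j : ℕ, a ≠ -(j : ℂ))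
    (hb : ∀ j : ℕ, b ≠ -(j : ℂ)) (hc : ∀ j : ℕ, c + N ≠ -(j : ℂ)) : tailFactor a b c N ≠ 0 :=
  div_ne_zero (mul_ne_zero (Complex.Gamma_ne_zero (add_natCast_ne ha N)) (poch_ne_zero hb N))
    (mul_ne_zero (Complex.Gamma_ne_zero hc) (factorial_ne_zero_complex N))

/-- Splitting each Gamma at index N turns the tail into Pochhammer symbols, with (N+j)! = N!
(N+1)_j. Only c + N has to avoid the poles, not c. -/
theorem tailFactor_mul_coef {a b c : ℂ} {N : ℕ} (ha : ∀ j : ℕ, a ≠ -(j : ℂ))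
    (hb : ∀ j : ℕ, b ≠ -(j : ℂ)) (hc : ∀ j : ℕ, c + N ≠ -(j : ℂ)) (j : ℕ) :
    tailFactor a b c N * (poch (a + N) j * poch (b + N) j * poch 1 j
        / (poch (c + N) j * poch (N + 1) j) / (j ! : ℂ))
      = (Complex.Gamma b)⁻¹ * hypCoef a b c (N + j) := by
  have e : ∀ x : ℂ, x + ((N + j : ℕ) : ℂ) = x + N + j := fun x => by push_cast; ring
  have h1 := Complex.Gamma_ne_zero hb
  have h2 := Complex.Gamma_ne_zero hc
  have h3 := factorial_ne_zero_complex N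
  have h4 := factorial_ne_zero_complex j
  have h5 := poch_ne_zero hc j
  have h6 : poch ((N : ℂ) + 1) j ≠ 0 := by
    intro h
    have := factorial_add_eq_poch N j
    rw [h, mul_zero] at this
    exact factorial_ne_zero_complex _ this
  rw [tailFactor, hypCoef, e, e, e, Gamma_add_natCast (add_natCast_ne ha N),
    Gamma_add_natCast (add_natCast_ne hb N), Gamma_add_natCast hb, Gamma_add_natCast hc,
    factorial_add_eq_poch, poch_one]
  field_simp

theorem hypSeries3F2_eq_pser (a b c : ℂ) (N : ℕ) (z : ℂ) :
    hypSeries3F2 (a + N) (b + N) 1 (c + N) (N + 1) z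
      = pser (fun j => poch (a + N) j * poch (b + N) j * poch 1 j
        / (poch (c + N) j * poch (N + 1) j) / (j ! : ℂ)) z := by
  rw [hypSeries3F2, pser]
  exact tsum_congr fun j => by ring

theorem ConvDisc.pow_mul_pser_natAdd {c : ℕ → ℂ} (hc : ConvDisc c) (N : ℕ) {z : ℂ}
    (hz : ‖z‖ < 1) :
    z ^ N * pser (fun j => c (N + j)) z = pser c z - ∑ k ∈ Finset.range N, c k * z ^ k := by
  rw [pser, pser, ← (hc.summable hz).sum_add_tsum_nat_add N, add_sub_cancel_left, ← tsum_mul_left]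
  refine tsum_congr fun j => ?_
  rw [add_comm N j, pow_add]
  ring

/-! ### Analytic continuation to the slit disc about 1 -/

section Continuation

variable {a b : ℂ} {M N : ℕ}

/-- The closed form of the continued function, before division by `z ^ N`. -/
noncomputable def connectionRhs (a b : ℂ) (M N : ℕ) (z : ℂ) : ℂ :=
  (Complex.Gamma b)⁻¹ * (polarPart a b M (1 - z)
    + logFactor a b M * logSer (logCoef a b M) (psiCoef a b M) (1 - z)
    - ∑ k ∈ Finset.range N, hypCoef a b (a + b - M) k * z ^ k)

theorem convDisc_coef (ha : ∀ j : ℕ, a ≠ -(j : ℂ)) (hb : ∀ j : ℕ, b ≠ -(j : ℂ))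
    (hc : ∀ j : ℕ, a + b - M + N ≠ -(j : ℂ)) :
    ConvDisc fun j => poch (a + N) j * poch (b + N) j * poch 1 j
        / (poch (a + b - M + N) j * poch (N + 1) j) / (j ! : ℂ) := by
  have h0 := tailFactor_ne_zero ha hb hc
  have h := ((convDisc_hypCoef ha hb M).natAdd N).const_mul
    ((tailFactor a b (a + b - M) N)⁻¹ * (Complex.Gamma b)⁻¹)
  refine h.of_norm_le 1 fun j => ?_
  rw [one_mul, mul_assoc (tailFactor a b (a + b - M) N)⁻¹, ← tailFactor_mul_coef ha hb hc j, inv_mul_cancel_left₀ h0]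

theorem hypSeries3F2_mul_eq (ha : ∀ j : ℕ, a ≠ -(j : ℂ)) (hb : ∀ j : ℕ, b ≠ -(j : ℂ))
    (hc : ∀ j : ℕ, a + b - M + N ≠ -(j : ℂ)) {z : ℂ} (hz : ‖z‖ < 1) (hw : ‖1 - z‖ < 1) :
    tailFactor a b (a + b - M) N * z ^ N
        * hypSeries3F2 (a + N) (b + N) 1 (a + b - M + N) (N + 1) z
      = connectionRhs a b M N z := by
  rw [hypSeries3F2_eq_pser, connectionRhs, ← pser_hypCoef_eq ha hb M hz hw,
    ← (convDisc_hypCoef ha hb M).pow_mul_pser_natAdd N hz, mul_right_comm, ← pser_const_mul,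
    funext (tailFactor_mul_coef ha hb hc), pser_const_mul]
  ring

theorem connectionRhs_differentiableAt (ha : ∀ j : ℕ, a ≠ -(j : ℂ)) (hb : ∀ j : ℕ, b ≠ -(j : ℂ))
    {z : ℂ} (hw : ‖1 - z‖ < 1) (hs : 1 - z ∈ Complex.slitPlane) :
    DifferentiableAt ℂ (connectionRhs a b M N) z := by
  have h1 := ((polarPart_hasDerivAt a b M (Complex.slitPlane_ne_zero hs)).comp_const_sub 1 z
    ).differentiableAt
  have h2 := (logSer_one_sub_hasDerivAt (convDisc_logCoef ha hb M) (convDisc_psiCoef ha hb M)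
    hw hs).differentiableAt
  unfold connectionRhs
  fun_prop

theorem mem_slitPlane_of_one_sub_smul {y : ℂ} {t : ℝ} (ht0 : 0 ≤ t) (ht1 : t ≤ 1)
    (hy : 1 - y ∈ Complex.slitPlane) : 1 - (t : ℂ) * y ∈ Complex.slitPlane := by
  rw [Complex.mem_slitPlane_iff] at hy ⊢
  simp only [Complex.sub_re, Complex.one_re, Complex.re_ofReal_mul, Complex.sub_im,
    Complex.one_im, Complex.im_ofReal_mul] at hy ⊢
  rcases ht0.eq_or_lt with rfl | ht
  · left
    simp
  rcases hy with hy | hy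
  · left
    rcases le_or_gt y.re 0 with h | h <;> nlinarith
  · right
    have : y.im ≠ 0 := by simpa using hy
    simpa using ⟨ht.ne', this⟩

/-- The closed form is the value of the principal branch of `₃F₂`. -/
theorem is3F2Value_connectionRhs (ha : ∀ j : ℕ, a ≠ -(j : ℂ)) (hb : ∀ j : ℕ, b ≠ -(j : ℂ))
    (hc : ∀ j : ℕ, a + b - M + N ≠ -(j : ℂ)) {z : ℂ} (hw : ‖1 - z‖ < 1)
    (hs : 1 - z ∈ Complex.slitPlane) :
    Is3F2Value (a + N) (b + N) 1 (a + b - M + N) (N + 1) z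
      (connectionRhs a b M N z / (tailFactor a b (a + b - M) N * z ^ N)) := by
  have hD := tailFactor_ne_zero ha hb hc
  set V : Set ℂ := {y | ‖1 - y‖ < 1} ∩ (fun y => 1 - y) ⁻¹' Complex.slitPlane with hV
  -- Series inside the unit disc, closed form outside; on the overlap they agree by
  -- `hypSeries3F2_mul_eq`. Division by y ^ N is safe because |1 - y| < 1 excludes 0.
  set F : ℂ → ℂ := fun y => if ‖y‖ < 1 then
    hypSeries3F2 (a + N) (b + N) 1 (a + b - M + N) (N + 1) y
    else connectionRhs a b M N y / (tailFactor a b (a + b - M) N * y ^ N) with hF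
  have hVo : IsOpen V := (isOpen_lt (by fun_prop) continuous_const).inter
    (Complex.isOpen_slitPlane.preimage (by fun_prop))
  have hBo : IsOpen (Metric.ball (0 : ℂ) 1) := Metric.isOpen_ball
  have hne : ∀ y : ℂ, ‖1 - y‖ < 1 → y ≠ 0 := by
    rintro y hy rfl
    simp at hy
  have hFB : ∀ y : ℂ, ‖y‖ < 1 → F y
      = hypSeries3F2 (a + N) (b + N) 1 (a + b - M + N) (N + 1) y := fun y hy => if_pos hy
  have hFV : ∀ y ∈ V, F y = connectionRhs a b M N y / (tailFactor a b (a + b - M) N * y ^ N) := by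
    intro y hy
    by_cases h : ‖y‖ < 1
    · rw [hFB y h, eq_div_iff (mul_ne_zero hD (pow_ne_zero _ (hne y hy.1))), mul_comm]
      exact hypSeries3F2_mul_eq ha hb hc h hy.1
    · exact if_neg h
  refine ⟨Metric.ball 0 1 ∪ V, F, hBo.union hVo, ?_, Or.inl (by simp), Or.inr ⟨hw, hs⟩, ?_, ?_,
    hFV z ⟨hw, hs⟩⟩
  · rw [starConvex_iff_forall_pos (show (0 : ℂ) ∈ Metric.ball 0 1 ∪ V from Or.inl (by simp))]
    intro y hy s t hs0 ht0 hst
    have ht1 : t ≤ 1 := by linarith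
    rw [smul_zero, zero_add, Complex.real_smul]
    rcases hy with hy | hy
    · left
      rw [Metric.mem_ball, dist_zero_right] at hy ⊢
      rw [norm_mul, Complex.norm_real, Real.norm_of_nonneg ht0.le]
      exact (mul_le_of_le_one_left (norm_nonneg _) ht1).trans_lt hy
    · right
      refine ⟨?_, mem_slitPlane_of_one_sub_smul ht0.le ht1 hy.2⟩
      -- A convex combination of 1 and 1 - y. As t > 0, its norm is strictly below 1; the endpoint t
      -- = 0 belongs only to the ball.
      have e : 1 - (t : ℂ) * y = s * 1 + t * (1 - y) := by
        have : (s : ℂ) + t = 1 := by exact_mod_cast hst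
        linear_combination -this
      have hy1 : ‖1 - y‖ < 1 := hy.1
      have : ‖(s : ℂ) * 1 + t * (1 - y)‖ ≤ s * 1 + t * ‖1 - y‖ := by
        refine (norm_add_le _ _).trans ?_
        rw [norm_mul, norm_mul, Complex.norm_real, Complex.norm_real, norm_one,
          Real.norm_of_nonneg hs0.le, Real.norm_of_nonneg ht0.le]
      change ‖1 - (t : ℂ) * y‖ < 1
      rw [e]
      nlinarith
  · rintro y (hy | hy)
    · rw [Metric.mem_ball, dist_zero_right] at hy
      have hd : DifferentiableAt ℂ
          (hypSeries3F2 (a + N) (b + N) 1 (a + b - M + N) (N + 1)) y := by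
        rw [funext (hypSeries3F2_eq_pser a b (a + b - M) N)]
        exact ((convDisc_coef ha hb hc).hasDerivAt hy).differentiableAt
      refine (hd.congr_of_eventuallyEq ?_).differentiableWithinAt
      filter_upwards [(continuous_norm.tendsto y).eventually_lt_const hy] with x hx using hFB x hx
    · have hd : DifferentiableAt ℂ
          (fun y => connectionRhs a b M N y / (tailFactor a b (a + b - M) N * y ^ N)) y :=
        (connectionRhs_differentiableAt ha hb hy.1 hy.2).div (by fun_prop)
          (mul_ne_zero hD (pow_ne_zero _ (hne y hy.1)))
      refine (hd.congr_of_eventuallyEq ?_).differentiableWithinAt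
      filter_upwards [hVo.mem_nhds hy] with x hx using hFV x hx
  · filter_upwards [(continuous_norm.tendsto (0 : ℂ)).eventually_lt_const
      (u := 1) (by simp)] with x hx using hFB x hx

/-- Binomial expansion of ((z - 1) + 1)^k followed by exchanging the two finite sums; the choice
coefficient over k! is 1/(l! (k-l)!). -/
theorem sum_hypCoef_mul_pow (hb : ∀ j : ℕ, b ≠ -(j : ℂ)) (c z : ℂ) :
    (Complex.Gamma b)⁻¹ * ∑ k ∈ Finset.range N, hypCoef a b c k * z ^ k
      = ∑ l ∈ Finset.range N, 1 / (l ! : ℂ) * (∑ k ∈ Finset.Ico l N,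
          poch b k * Complex.Gamma (a + k) / (Complex.Gamma (c + k) * ((k - l)! : ℂ)))
          * (z - 1) ^ l := by
  have hG := Complex.Gamma_ne_zero hb
  have h1 : ∀ k : ℕ, (Complex.Gamma b)⁻¹ * (hypCoef a b c k * z ^ k)
      = ∑ l ∈ Finset.range (k + 1), 1 / (l ! : ℂ) * (poch b k * Complex.Gamma (a + k)
        / (Complex.Gamma (c + k) * ((k - l)! : ℂ))) * (z - 1) ^ l := by
    intro k
    have hz : z ^ k = ((z - 1) + 1) ^ k := by ring
    rw [hz, add_pow, Finset.mul_sum, Finset.mul_sum]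
    refine Finset.sum_congr rfl fun l hl => ?_
    have hl' : l ≤ k := by
      have := Finset.mem_range.1 hl
      omega
    have hch := Nat.choose_mul_factorial_mul_factorial hl'
    have hch' : (k.choose l : ℂ) * (l ! : ℂ) * ((k - l)! : ℂ) = (k ! : ℂ) := by exact_mod_cast hch
    have f1 := factorial_ne_zero_complex l
    have f2 := factorial_ne_zero_complex (k - l)
    have f3 := factorial_ne_zero_complex k
    have e : (k.choose l : ℂ) / (k ! : ℂ) = 1 / ((l ! : ℂ) * ((k - l)! : ℂ)) := by
      rw [div_eq_div_iff f3 (mul_ne_zero f1 f2)]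
      linear_combination hch'
    rw [hypCoef, Gamma_add_natCast hb, one_pow]
    calc _ = (Complex.Gamma b)⁻¹ * Complex.Gamma b * Complex.Gamma (a + k) * poch b k
          * (Complex.Gamma (c + k))⁻¹ * ((k.choose l : ℂ) / (k ! : ℂ)) * (z - 1) ^ l := by ring
      _ = _ := by
        rw [e, inv_mul_cancel₀ hG]
        ring
  rw [Finset.mul_sum, Finset.sum_congr rfl fun k _ => h1 k]
  simp only [Finset.mul_sum, Finset.sum_mul]
  refine Finset.sum_comm' fun k l => ?_
  simp only [Finset.mem_range, Finset.mem_Ico]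
  omega

theorem logSer_term (ha : ∀ j : ℕ, a ≠ -(j : ℂ)) (hb : ∀ j : ℕ, b ≠ -(j : ℂ)) {w : ℂ}
    (hw : ‖w‖ < 1) :
    HasSum (fun k : ℕ => logCoef a b M k * (Complex.log w + digammaSum a b M k) * w ^ k)
      (logSer (logCoef a b M) (psiCoef a b M) w) := by
  have h1 := ((convDisc_logCoef ha hb M).summable hw).hasSum.mul_left (Complex.log w)
  have h2 := ((convDisc_psiCoef ha hb M).summable hw).hasSum
  convert! h1.add h2 using 1
  funext k
  rw [psiCoef]
  ring

end Continuation

/-! ### The formula in the original parameters -/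

/-- The logarithmic connection formula for `₃F₂(β, ν, 1; β + σ, n; z)`. -/
theorem hyp3F2_connection (n : ℕ) (hn : 1 ≤ n) (m : ℕ) (ν β z : ℂ)
    (hν : ∀ j : ℕ, ν - n ≠ -(j : ℂ)) (hβ : ∀ j : ℕ, β - n + 1 ≠ -(j : ℂ))
    (hz : ‖1 - z‖ < 1) (hs : 1 - z ∈ Complex.slitPlane) (σ : ℂ) (hσ : ν - σ - n = m)
    (hc : ∀ j : ℕ, β + σ ≠ -(j : ℂ)) :
    Is3F2Value β ν 1 (β + σ) n z (hyp3F2 β ν 1 (β + σ) n z) ∧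
    Summable (fun k : ℕ =>
      poch (β - n + 1) k * poch (ν + 1 - n) k / (((k + m + 1)! : ℂ) * (k ! : ℂ)) *
        (Complex.log (1 - z) - Complex.digamma (k + 1) + Complex.digamma (k + ν + 1 - n)
          + Complex.digamma (β - n + k + 1) - Complex.digamma (ν - σ - n + 2 + k)) *
        (1 - z) ^ k) ∧
    Complex.Gamma β * poch (ν - n) n / (Complex.Gamma (β + σ) * (ν - n) * ((n - 1)! : ℂ)) *
        z ^ (n - 1) * hyp3F2 β ν 1 (β + σ) n z =
      1 / Complex.Gamma (1 - n + ν) * (1 - z) ^ ((n : ℂ) - ν - 1 + σ) *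
          ∑ k ∈ Finset.range (m + 1), (-1 : ℂ) ^ k / (k ! : ℂ) * poch (β + σ - ν) k * poch σ k *
            Complex.Gamma (1 + ν - σ - n - k) * (1 - z) ^ k
      + (-1 : ℂ) ^ m * (Complex.Gamma (β - n + 1) /
            (Complex.Gamma (β + σ - ν) * Complex.Gamma σ)) *
          ∑' k : ℕ, poch (β - n + 1) k * poch (ν + 1 - n) k / (((k + m + 1)! : ℂ) * (k ! : ℂ)) *
            (Complex.log (1 - z) - Complex.digamma (k + 1) + Complex.digamma (k + ν + 1 - n)
              + Complex.digamma (β - n + k + 1) - Complex.digamma (ν - σ - n + 2 + k)) *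
            (1 - z) ^ k
      - ∑ l ∈ Finset.range (n - 1), 1 / (l ! : ℂ) *
          (∑ k ∈ Finset.Ico l (n - 1), poch (ν - n + 1) k * Complex.Gamma (k - n + β + 1) /
            (Complex.Gamma (k - n + β + σ + 1) * ((k - l)! : ℂ))) * (z - 1) ^ l := by
  -- In the parameters N, a, b the lower parameter β + σ becomes c + N with c = a + b - (m+1). Hence
  -- the ₂F₁ formula is used with M = m + 1.
  obtain ⟨N, rfl⟩ : ∃ N, n = N + 1 := ⟨n - 1, by omega⟩
  obtain ⟨a, rfl⟩ : ∃ a, β = a + N := ⟨β - N, by ring⟩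
  obtain ⟨b, rfl⟩ : ∃ b, ν = b + N := ⟨ν - N, by ring⟩
  obtain rfl : σ = b - (m + 1 : ℕ) := by
    push_cast at hσ ⊢
    linear_combination -hσ
  have i1 : a + N - ((N + 1 : ℕ) : ℂ) + 1 = a := by push_cast; ring
  have i2 : b + N - ((N + 1 : ℕ) : ℂ) = b - 1 := by push_cast; ring
  have i3 : a + N + (b - ((m + 1 : ℕ) : ℂ)) = a + b - (m + 1 : ℕ) + N := by ring
  have i4 : a + b - ((m + 1 : ℕ) : ℂ) + N - (b + N) = a - (m + 1 : ℕ) := by ring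
  have i5 : b + N + 1 - ((N + 1 : ℕ) : ℂ) = b := by push_cast; ring
  have i6 : ∀ k : ℕ, (k : ℂ) + (b + N) + 1 - ((N + 1 : ℕ) : ℂ) = b + k := by
    intro k; push_cast; ring
  have i7 : ∀ k : ℕ, a + N - ((N + 1 : ℕ) : ℂ) + k + 1 = a + k := by intro k; push_cast; ring
  have i8 : ∀ k : ℕ, b + N - (b - ((m + 1 : ℕ) : ℂ)) - ((N + 1 : ℕ) : ℂ) + 2 + k
      = k + (m + 1 : ℕ) + 1 := by intro k; push_cast; ring
  have i9 : 1 - ((N + 1 : ℕ) : ℂ) + (b + N) = b := by push_cast; ring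
  have i10 : ((N + 1 : ℕ) : ℂ) - (b + N) - 1 + (b - ((m + 1 : ℕ) : ℂ))
      = ((-((m + 1 : ℕ) : ℤ) : ℤ) : ℂ) := by push_cast; ring
  have i11 : ∀ k : ℕ, 1 + (b + N) - (b - ((m + 1 : ℕ) : ℂ)) - ((N + 1 : ℕ) : ℂ) - k
      = (m + 1 : ℕ) - k := by intro k; push_cast; ring
  have i12 : b - 1 + 1 = b := by ring
  have i13 : ∀ k : ℕ, (k : ℂ) - ((N + 1 : ℕ) : ℂ) + (a + N) + 1 = a + k := by
    intro k; push_cast; ring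
  have i14 : ∀ k : ℕ, (k : ℂ) - ((N + 1 : ℕ) : ℂ) + (a + N) + (b - ((m + 1 : ℕ) : ℂ)) + 1
      = a + b - (m + 1 : ℕ) + k := by intro k; push_cast; ring
  have ha : ∀ j : ℕ, a ≠ -(j : ℂ) := by simpa only [i1] using hβ
  -- The hypothesis on ν - n also excludes b = 1, so the quotient by ν - n = b - 1 in the prefactor
  -- is genuine.
  have hb1 : ∀ j : ℕ, b - 1 ≠ -(j : ℂ) := by simpa only [i2] using hν
  have hb : ∀ j : ℕ, b ≠ -(j : ℂ) := fun j hj => hb1 (j + 1) (by rw [hj]; push_cast; ring)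
  rw [i3] at hc
  have hb10 : b - 1 ≠ 0 := by simpa using hb1 0
  have hw0 := Complex.slitPlane_ne_zero hs
  have hz0 : z ≠ 0 := by
    rintro rfl
    simp at hz
  have hval := is3F2Value_connectionRhs ha hb hc hz hs
  have hterm := logSer_term (M := m + 1) ha hb hz
  have hfun : ∀ k : ℕ, poch a k * poch b k / (((k + m + 1)! : ℂ) * (k ! : ℂ)) *
      (Complex.log (1 - z) - Complex.digamma (k + 1) + Complex.digamma (b + k)
        + Complex.digamma (a + k) - Complex.digamma (k + (m + 1 : ℕ) + 1)) * (1 - z) ^ k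
      = logCoef a b (m + 1) k * (Complex.log (1 - z) + digammaSum a b (m + 1) k)
        * (1 - z) ^ k := by
    intro k
    rw [logCoef, digammaSum, ← add_assoc k m 1]
    ring
  simp only [i1, i2, i3, i4, i5, i6, i7, i8, i9, i10, i11, i12, i13, i14, hfun,
    Nat.add_sub_cancel]
  have hN1 : ((N + 1 : ℕ) : ℂ) = N + 1 := by push_cast; rfl
  rw [hN1, hval.hyp3F2_eq]
  refine ⟨hval, hterm.summable, ?_⟩
  have hD := tailFactor_ne_zero ha hb hc
  -- Here (b-1)_{N+1}/(b-1) = (b)_N.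
  have hpre : Complex.Gamma (a + N) * poch (b - 1) (N + 1)
      / (Complex.Gamma (a + b - (m + 1 : ℕ) + N) * (b - 1) * (N ! : ℂ))
      = tailFactor a b (a + b - (m + 1 : ℕ)) N := by
    rw [tailFactor, poch_succ_left, sub_add_cancel]
    have := Complex.Gamma_ne_zero hc
    have := factorial_ne_zero_complex N
    field_simp
  have hpol : (Complex.Gamma b)⁻¹ * polarPart a b (m + 1) (1 - z)
      = 1 / Complex.Gamma b * (1 - z) ^ (-((m + 1 : ℕ) : ℤ))
        * ∑ k ∈ Finset.range (m + 1), (-1 : ℂ) ^ k / (k ! : ℂ) * poch (a - (m + 1 : ℕ)) k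
          * poch (b - (m + 1 : ℕ)) k * Complex.Gamma ((m + 1 : ℕ) - k) * (1 - z) ^ k := by
    rw [polarPart, one_div, mul_assoc, Finset.mul_sum _ _ ((1 - z) ^ (-((m + 1 : ℕ) : ℤ)))]
    congr 1
    refine Finset.sum_congr rfl fun k _ => ?_
    rw [polarCoef, sub_eq_add_neg (k : ℤ), zpow_add₀ hw0, zpow_natCast]
    ring
  -- The sign in `logFactor` is (-1)^(M+1) = (-1)^(m+2) = (-1)^m, and its Pochhammer symbols shift
  -- 1/Γ(a) and 1/Γ(b) by m + 1.
  have hlog : (Complex.Gamma b)⁻¹ * logFactor a b (m + 1)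
      = (-1 : ℂ) ^ m * (Complex.Gamma a / (Complex.Gamma (a - (m + 1 : ℕ))
        * Complex.Gamma (b - (m + 1 : ℕ)))) := by
    have g1 := Complex.Gamma_ne_zero ha
    have g2 := Complex.Gamma_ne_zero hb
    rw [div_eq_mul_inv, mul_inv, inv_Gamma_eq_poch_mul (a - (m + 1 : ℕ)) (m + 1),
      inv_Gamma_eq_poch_mul (b - (m + 1 : ℕ)) (m + 1), sub_add_cancel, sub_add_cancel, logFactor]
    field_simp
    ring
  rw [hpre, mul_div_cancel₀ _ (mul_ne_zero hD (pow_ne_zero _ hz0)), connectionRhs, mul_sub,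
    mul_add, ← mul_assoc, hlog, hpol, sum_hypCoef_mul_pow hb, hterm.tsum_eq,
    Complex.cpow_intCast]

theorem slitPlane_of_arg {w : ℂ} (hw : w ≠ 0) (h : |Complex.arg w| < Real.pi) :
    w ∈ Complex.slitPlane :=
  Complex.mem_slitPlane_iff_arg.2 ⟨fun h' => by rw [h', abs_of_pos Real.pi_pos] at h
                                                exact lt_irrefl _ h, hw⟩

theorem mainTheorem3 (n : ℕ) (hn : 1 ≤ n) (m : ℕ) (ν β z : ℂ)
    (hν : ∀ j : ℕ, ν - n ≠ -(j : ℂ)) (hβ : ∀ j : ℕ, β - n + 1 ≠ -(j : ℂ))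
    (hz : ‖1 - z‖ < 1) (hz1 : z ≠ 1) (harg : |Complex.arg (1 - z)| < Real.pi) :
    (∀ σ : ℂ, ν - σ - n = m → (∀ j : ℕ, β + σ ≠ -(j : ℂ)) →
      Is3F2Value β ν 1 (β + σ) n z (hyp3F2 β ν 1 (β + σ) n z) ∧
      Summable (fun k : ℕ =>
        poch (β - n + 1) k * poch (ν + 1 - n) k / (((k + m + 1)! : ℂ) * (k ! : ℂ)) *
          (Complex.log (1 - z) - Complex.digamma (k + 1) + Complex.digamma (k + ν + 1 - n)
            + Complex.digamma (β - n + k + 1) - Complex.digamma (ν - σ - n + 2 + k)) *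
          (1 - z) ^ k) ∧
      Complex.Gamma β * poch (ν - n) n / (Complex.Gamma (β + σ) * (ν - n) * ((n - 1)! : ℂ)) *
          z ^ (n - 1) * hyp3F2 β ν 1 (β + σ) n z =
        1 / Complex.Gamma (1 - n + ν) * (1 - z) ^ ((n : ℂ) - ν - 1 + σ) *
            ∑ k ∈ Finset.range (m + 1), (-1 : ℂ) ^ k / (k ! : ℂ) * poch (β + σ - ν) k * poch σ k *
              Complex.Gamma (1 + ν - σ - n - k) * (1 - z) ^ k
        + (-1 : ℂ) ^ m * (Complex.Gamma (β - n + 1) /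
              (Complex.Gamma (β + σ - ν) * Complex.Gamma σ)) *
            ∑' k : ℕ, poch (β - n + 1) k * poch (ν + 1 - n) k / (((k + m + 1)! : ℂ) * (k ! : ℂ)) *
              (Complex.log (1 - z) - Complex.digamma (k + 1) + Complex.digamma (k + ν + 1 - n)
                + Complex.digamma (β - n + k + 1) - Complex.digamma (ν - σ - n + 2 + k)) *
              (1 - z) ^ k
        - ∑ l ∈ Finset.range (n - 1), 1 / (l ! : ℂ) *
            (∑ k ∈ Finset.Ico l (n - 1), poch (ν - n + 1) k * Complex.Gamma (k - n + β + 1) /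
              (Complex.Gamma (k - n + β + σ + 1) * ((k - l)! : ℂ))) * (z - 1) ^ l) ∧
    ((∀ j : ℕ, β + ν - m - n ≠ -(j : ℂ)) →
      Is3F2Value β ν 1 (β + ν - m - n) n z (hyp3F2 β ν 1 (β + ν - m - n) n z) ∧
      Summable (fun k : ℕ =>
        poch (β - n + 1) k * poch (ν + 1 - n) k / (((k + m + 1)! : ℂ) * (k ! : ℂ)) *
          (Complex.log (1 - z) - Complex.digamma (k + 1) + Complex.digamma (k + ν + 1 - n)
            + Complex.digamma (β - n + k + 1) - Complex.digamma (k + m + 2)) *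
          (1 - z) ^ k) ∧
      Complex.Gamma β * poch (ν - n) n /
            (Complex.Gamma (β + ν - m - n) * (ν - n) * ((n - 1)! : ℂ)) *
          z ^ (n - 1) * hyp3F2 β ν 1 (β + ν - m - n) n z =
        (1 - z) ^ (-(m : ℤ) - 1) / Complex.Gamma (1 - n + ν) *
            ∑ k ∈ Finset.range (m + 1), (-1 : ℂ) ^ k / (k ! : ℂ) * poch (β - m - n) k *
              poch (ν - m - n) k * Complex.Gamma (1 + m - k) * (1 - z) ^ k
        + (-1 : ℂ) ^ m * (Complex.Gamma (β - n + 1) /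
              (Complex.Gamma (β - m - n) * Complex.Gamma (ν - m - n))) *
            ∑' k : ℕ, poch (β - n + 1) k * poch (ν + 1 - n) k / (((k + m + 1)! : ℂ) * (k ! : ℂ)) *
              (Complex.log (1 - z) - Complex.digamma (k + 1) + Complex.digamma (k + ν + 1 - n)
                + Complex.digamma (β - n + k + 1) - Complex.digamma (k + m + 2)) *
              (1 - z) ^ k
        - ∑ l ∈ Finset.range (n - 1), 1 / (l ! : ℂ) *
            (∑ k ∈ Finset.Ico l (n - 1), poch (ν - n + 1) k * Complex.Gamma (k - n + β + 1) /
              (Complex.Gamma (k - 2 * n - m + ν + β + 1) * ((k - l)! : ℂ))) * (z - 1) ^ l) := by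
  have hs := slitPlane_of_arg (sub_ne_zero.2 (Ne.symm hz1)) harg
  refine ⟨hyp3F2_connection n hn m ν β z hν hβ hz hs, fun hc => ?_⟩
  have e1 : β + (ν - m - n) = β + ν - m - n := by ring
  have e2 : ∀ k : ℕ, ν - (ν - m - n) - n + 2 + k = k + m + 2 := by intro k; ring
  have e3 : β + ν - m - n - ν = β - m - n := by ring
  have e4 : ∀ k : ℕ, 1 + ν - (ν - m - n) - n - k = 1 + m - k := by intro k; ring
  have e5 : ∀ k : ℕ, (k : ℂ) - n + β + (ν - m - n) + 1 = k - 2 * n - m + ν + β + 1 := by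
    intro k; ring
  have e6 : (n : ℂ) - ν - 1 + (ν - m - n) = ((-(m : ℤ) - 1 : ℤ) : ℂ) := by push_cast; ring
  have h := hyp3F2_connection n hn m ν β z hν hβ hz hs (ν - m - n) (by ring) (by rwa [e1])
  simp only [e1, e2, e3, e4, e5, e6, Complex.cpow_intCast] at h
  rw [div_eq_mul_one_div ((1 - z) ^ (-(m : ℤ) - 1)), mul_comm _ (1 / Complex.Gamma (1 - n + ν))]
  exact h
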